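/- Let $n\ge 1$, let $K_n$ be the complete graph (without loops) on the vertex set $V=\{0,\dots,n-1\}$, and let $\tau$ be a (non-empty, not necessarily spanning) subtree of $K_n$. The algorithm $\textbf{Seeded-Tree}(n,\tau)$ is the following. Put $V_X=V(\tau)$ and $E_X=E(\tau)$. While $V_X\neq V$, choose $v\in V\setminus V_X$ uniformly at random, run a simple random walk on $K_n$ from $v$ until it first visits $V_X$, erase its loops in the order in which they are created, and add the vertices and edges of the resulting path to $V_X$ and $E_X$ (this is Wilson's algorithm on $K_n$ with initial tree $\tau$). Then draw a uniformly random permutation $\sigma$ of $V$ by a Fisher–Yates shuffle, and output the graph on $V$ with edges $\{\sigma(a),\sigma(b)\}$, $\{a,b\}\in E_X$. For a tree $T$ with vertex set $V$ let $N_\tau(T)$ be the number of subgraphs of $T$ that are isomorphic to $\tau$. Then Seeded-Tree$(n,\tau)$ halts almost surely, its output is almost surely a tree with vertex set $V$, and for each such tree $T$ $$\mathbb P\big(\text{Seeded-Tree}(n,\tau)\text{ outputs }T\big)=\frac{N_\tau(T)}{\sum_{T'}N_\tau(T')},$$ where $T'$ runs over all trees with vertex set $V$. Moreover its expected running time is $O(n)$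 uniformly in $\tau$: there is an absolute constant $C$ such that for all $n$ and $\tau$ (given by a list of its vertices and a list of its edges) the expected number of elementary steps is at most $Cn$. Here an elementary step reads and writes a bounded number of memory cells and draws at most one uniformly random element. Each of the following costs at least one step: the initialisation of an array cell, the reading of a vertex or edge of $\tau$, a choice of a starting vertex, a step of the random walk, the removal of a vertex from the path when a loop is erased, the addition of a path vertex (with its edge) to the tree, a transposition of the shuffle, and the relabelling of an edge. -/

import Mathlib

open scoped ENNReal NNReal

noncomputable section

namespace SeededTree

/-! ## The randomised procedure, one elementary operation at a time

The memory consists of arrays indexed by the vertices `0, …, n - 1` and of stacks (lists that are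
only accessed at their head).  One execution of `step` inspects and changes a bounded number of
array cells and stack heads, and draws at most one uniform random element.  The running time is the
number of executed steps. -/

/-- The program counter. -/
inductive Phase (n : ℕ) where
  /-- initialise the arrays; `k` cells remain -/
  | init (k : ℕ)
  /-- put the vertices of the initial tree into `V_X` -/
  | loadVertices
  /-- put the edges of the initial tree into `E_X` -/
  | loadEdges
  /-- if `V_X ≠ V`, choose a vertex outside `V_X` uniformly at random -/
  | choose
  /-- make one step of the random walk -/
  | walk
  /-- erase the loop that was just closed at `u`, one vertex at a time -/
  | erase (u : Fin n)
  /-- move the loop-erased path into the tree, one vertex at a time -/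
  | attach
  /-- Fisher--Yates shuffle of the labels; the cells `0, …, i - 1` remain to be treated -/
  | shuffle (i : Fin (n + 1))
  /-- apply the shuffled labels, one edge at a time -/
  | relabel
  /-- halted -/
  | done

/-- The memory of the procedure on the vertex set `Fin n`. -/
structure Config (n : ℕ) where
  /-- program counter -/
  phase : Phase n
  /-- input: vertices of the initial tree that are still to be read -/
  inV : List (Fin n)
  /-- input: edges of the initial tree that are still to be read -/
  inE : List (Fin n × Fin n)
  /-- An arrangement of all vertices in an array, stored together with the inverse array that gives
  the slot `slot.symm v` of a vertex `v`. -/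
  slot : Equiv.Perm (Fin n)
  /-- The first `free` slots hold the vertices outside `V_X`, the other slots those of `V_X`. -/
  free : Fin (n + 1)
  /-- the edges `E_X` of the current tree -/
  edges : List (Fin n × Fin n)
  /-- the current loop-erased path; its head is the position of the walker -/
  path : List (Fin n)
  /-- `mark v` records whether `v` lies on `path` -/
  mark : Fin n → Bool
  /-- the new label `label v` of each vertex `v` -/
  label : Equiv.Perm (Fin n)
  /-- output: edges of the relabelled tree -/
  out : List (Fin n × Fin n)

variable {n : ℕ}

/-- `v ∈ V_X`, tested by looking up the slot of `v`. -/
def Config.inTree (c : Config n) (v : Fin n) : Prop := (c.free : ℕ) ≤ (c.slot.symm v : ℕ)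

instance (c : Config n) (v : Fin n) : Decidable (c.inTree v) := by
  unfold Config.inTree; infer_instance

/-- `V_X ← V_X ∪ {v}`: exchange `v` with the last vertex outside `V_X` and shorten the first part of
the arrangement by one slot. -/
def Config.addVertex (c : Config n) (v : Fin n) : Config n :=
  if h : (c.slot.symm v : ℕ) < (c.free : ℕ) then
    { c with
      slot := c.slot * Equiv.swap (c.slot.symm v) ⟨(c.free : ℕ) - 1, by have := c.free.isLt; omega⟩
      free := ⟨(c.free : ℕ) - 1, by have := c.free.isLt; omega⟩ }
  else c

/-- Draw a uniform element of `s` and continue with `f`; if `s` is empty, continue with `c`. -/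
def draw {α : Type} (s : Finset α) (f : α → Config n) (c : Config n) : PMF (Config n) :=
  open Classical in if h : s.Nonempty then (PMF.uniformOfFinset s h).map f else PMF.pure c

/-- One elementary operation of: Wilson's algorithm on `G` from the given initial tree, followed by
a uniform shuffle of the labels. -/
def step (G : SimpleGraph (Fin n)) [DecidableRel G.Adj] (c : Config n) : PMF (Config n) :=
  match c.phase with
  | .init 0 => PMF.pure { c with phase := .loadVertices }
  | .init (k + 1) => PMF.pure { c with phase := .init k }
  | .loadVertices =>
    match c.inV with
    | [] => PMF.pure { c with phase := .loadEdges }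
    | v :: vs => PMF.pure { c.addVertex v with inV := vs }
  | .loadEdges =>
    match c.inE with
    | [] => PMF.pure { c with phase := .choose }
    | e :: es => PMF.pure { c with inE := es, edges := e :: c.edges }
  | .choose =>
    draw (Finset.univ.filter fun i : Fin n => (i : ℕ) < (c.free : ℕ))
      (fun i => { c with
        phase := .walk
        path := [c.slot i]
        mark := Function.update c.mark (c.slot i) true })
      { c with phase := .shuffle (Fin.last n) }
  | .walk =>
    match c.path with
    | [] => PMF.pure { c with phase := .choose }
    | v :: rest =>
      draw (G.neighborFinset v)
        (fun u =>
          if c.inTree u then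
            { c with phase := .attach, edges := (v, u) :: c.edges }
          else if c.mark u then
            { c with phase := .erase u }
          else
            { c with path := u :: v :: rest, mark := Function.update c.mark u true })
        c
  | .erase u =>
    match c.path with
    | [] => PMF.pure { c with phase := .choose }
    | v :: rest =>
      if v = u then PMF.pure { c with phase := .walk }
      else PMF.pure { c with path := rest, mark := Function.update c.mark v false }
  | .attach =>
    match c.path with
    | [] => PMF.pure { c with phase := .choose }
    | [v] => PMF.pure { c.addVertex v with path := [], mark := Function.update c.mark v false }
    | v :: w :: rest => PMF.pure { c.addVertex v with
        path := w :: rest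
        mark := Function.update c.mark v false
        edges := (w, v) :: c.edges }
  | .shuffle i =>
    if h : 0 < (i : ℕ) then
      draw (Finset.Iic (⟨(i : ℕ) - 1, by have := i.isLt; omega⟩ : Fin n))
        (fun j => { c with
          phase := .shuffle ⟨(i : ℕ) - 1, by have := i.isLt; omega⟩
          label := c.label *
            Equiv.swap (⟨(i : ℕ) - 1, by have := i.isLt; omega⟩ : Fin n) j })
        c
    else PMF.pure { c with phase := .relabel }
  | .relabel =>
    match c.edges with
    | [] => PMF.pure { c with phase := .done }
    | (a, b) :: es => PMF.pure { c with
        edges := es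
        out := (c.label a, c.label b) :: c.out }
  | .done => PMF.pure c

/-- The start: the input is the list of vertices and the list of edges of the initial tree. -/
def start (vs : List (Fin n)) (es : List (Fin n × Fin n)) : Config n where
  phase := .init n
  inV := vs
  inE := es
  slot := Equiv.refl _
  free := Fin.last n
  edges := []
  path := []
  mark := fun _ => false
  label := Equiv.refl _
  out := []

/-- Law of the memory of Seeded-Tree after `t` steps; the graph is the complete graph. -/
def law (vs : List (Fin n)) (es : List (Fin n × Fin n)) : ℕ → PMF (Config n)
  | 0 => PMF.pure (start vs es)
  | t + 1 => (law vs es t).bind (step (⊤ : SimpleGraph (Fin n)))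

/-- The graph on all `n` vertices whose edges are the ones written to the output. -/
def Config.result (c : Config n) : SimpleGraph (Fin n) :=
  SimpleGraph.fromEdgeSet {e | ∃ p ∈ c.out, e = s(p.1, p.2)}

/-- The probability that Seeded-Tree halts and outputs `T`. (The events increase with `t`, because
`done` is absorbing.) -/
def outputProb (vs : List (Fin n)) (es : List (Fin n × Fin n)) (T : SimpleGraph (Fin n)) : ℝ≥0∞ :=
  ⨆ t : ℕ, (law vs es t).toOuterMeasure {c | c.phase = .done ∧ c.result = T}

/-- The expected number of steps executed before halting: the sum over `t` of the probability that
step `t` is executed. It is infinite if the procedure fails to halt with positive probability. -/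
def expectedTime (vs : List (Fin n)) (es : List (Fin n × Fin n)) : ℝ≥0∞ :=
  ∑' t : ℕ, (law vs es t).toOuterMeasure {c | c.phase ≠ .done}

/-- `vs` and `es` list the vertices and the edges of `τ`, each of them once. -/
def Encodes (τ : (⊤ : SimpleGraph (Fin n)).Subgraph) (vs : List (Fin n))
    (es : List (Fin n × Fin n)) : Prop :=
  vs.Nodup ∧ (∀ v, v ∈ vs ↔ v ∈ τ.verts) ∧
  (es.map fun e => s(e.1, e.2)).Nodup ∧
  (∀ e, e ∈ es.map (fun e => s(e.1, e.2)) ↔ e ∈ τ.edgeSet)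

/-- The number of subgraphs of `T` that are isomorphic to `τ`. (Each of them is a tree if `τ` is.) -/
def copies (τ : (⊤ : SimpleGraph (Fin n)).Subgraph) (T : SimpleGraph (Fin n)) : ℕ :=
  Nat.card {S : T.Subgraph // Nonempty (S.coe ≃g τ.coe)}

end SeededTree

end

/-! The procedure is a Markov chain on configurations, and each claim about it comes from a function
of the current configuration that is controlled over a single step. `Inv` is an invariant;
`potential` decreases by at least one in mean per executed step (`potential_step`), so it bounds the
expected time; `outputValue` is bounded and harmonic and equals the indicator of "output `T`" on
halted configurations (`outputValue_harmonic`), so by `iSup_chain_eq_of_harmonic` its initial value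
is the probability of `T`. No general theory of loop-erased walks is needed, because on the complete
graph the average over one walk step can be summed explicitly.

Law of the grown tree. A tree on `k` vertices lies in `k * n ^ (n - k - 1)` spanning trees of the
complete graph, and Wilson's algorithm should choose among them uniformly; `completionWeight` is the
reciprocal of this number. Fix a target tree and orient it towards a vertex of the seed by a parent
map `p`. The current path is worth keeping only as far as it follows `p`: `pathWeight` adds to the
value of the whole path the contributions of detours that return to an earlier point of it. That
this guess is harmonic is `pathWeight_average`, which feeds `sum_treeValue_moveTo`.

Law of the output. Averaging over the `n!` relabellings, the probability of `T` is a constant times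
the number of permutations that carry the edges of the seed into `T` (`outputProb_eq`). Grouped by
the image of the seed, these form cosets of its stabiliser (`card_embeddings`), so the probability
is proportional to the number of copies. The probabilities sum to one (`tsum_outputProb`), which
determines the constant without any count of trees.

Running time. `walkTime` solves the recurrence for the expected number of remaining walk steps
(`walkTime_recurrence`), which is at most `2 * (n - 1)`. Every other operation is charged to a walk
step, to a vertex or to a bounded number of changes of phase. -/

noncomputable section

namespace SeededTree

/-! ## Expectations and Markov chains with countably many outcomes -/

section Markov

variable {α β : Type}

/-- The expectation of `h` under `p`. -/
def expect (p : PMF α) (h : α → ℝ≥0∞) : ℝ≥0∞ := ∑' a, p a * h a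

theorem expect_pure (a : α) (h : α → ℝ≥0∞) : expect (PMF.pure a) h = h a := by
  unfold expect
  rw [tsum_eq_single a]
  · simp
  · intro b hb
    simp [hb]

theorem expect_bind (p : PMF α) (f : α → PMF β) (h : β → ℝ≥0∞) :
    expect (p.bind f) h = expect p fun a => expect (f a) h := by
  unfold expect
  simp_rw [PMF.bind_apply, ← ENNReal.tsum_mul_right, ← ENNReal.tsum_mul_left]
  rw [ENNReal.tsum_comm]
  simp_rw [mul_assoc]

theorem expect_map (p : PMF α) (f : α → β) (h : β → ℝ≥0∞) :
    expect (p.map f) h = expect p (h ∘ f) := by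
  rw [← PMF.bind_pure_comp, expect_bind]
  simp [expect_pure, Function.comp_def]

theorem expect_uniformOfFinset (s : Finset α) (hs : s.Nonempty) (h : α → ℝ≥0∞) :
    expect (PMF.uniformOfFinset s hs) h = (∑ a ∈ s, h a) / (s.card : ℝ≥0∞) := by
  unfold expect
  rw [tsum_eq_sum (s := s)]
  · rw [ENNReal.div_eq_inv_mul, Finset.mul_sum]
    refine Finset.sum_congr rfl fun a ha => ?_
    rw [PMF.uniformOfFinset_apply_of_mem _ ha]
  · intro b hb
    rw [PMF.uniformOfFinset_apply_of_notMem _ hb, zero_mul]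

theorem expect_congr {p : PMF α} {h h' : α → ℝ≥0∞} (H : ∀ a ∈ p.support, h a = h' a) :
    expect p h = expect p h' := by
  unfold expect
  refine tsum_congr fun a => ?_
  by_cases ha : p a = 0
  · simp [ha]
  · rw [H a ((PMF.mem_support_iff _ _).2 ha)]

theorem expect_mono {p : PMF α} {h h' : α → ℝ≥0∞} (H : ∀ a ∈ p.support, h a ≤ h' a) :
    expect p h ≤ expect p h' := by
  unfold expect
  refine ENNReal.tsum_le_tsum fun a => ?_
  by_cases ha : p a = 0
  · simp [ha]
  · exact mul_le_mul_right (H a ((PMF.mem_support_iff _ _).2 ha)) _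

theorem expect_add (p : PMF α) (h h' : α → ℝ≥0∞) :
    expect p (fun a => h a + h' a) = expect p h + expect p h' := by
  unfold expect
  simp_rw [mul_add]
  exact ENNReal.tsum_add

theorem expect_const_mul (p : PMF α) (c : ℝ≥0∞) (h : α → ℝ≥0∞) :
    expect p (fun a => c * h a) = c * expect p h := by
  unfold expect
  rw [← ENNReal.tsum_mul_left]
  refine tsum_congr fun a => by ring

theorem expect_one (p : PMF α) : expect p (fun _ => 1) = 1 := by
  simp [expect, p.tsum_coe]

theorem expect_sum {ι : Type} (p : PMF α) (s : Finset ι) (h : ι → α → ℝ≥0∞) :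
    expect p (fun a => ∑ i ∈ s, h i a) = ∑ i ∈ s, expect p (h i) := by
  classical
  induction s using Finset.induction_on with
  | empty => simp [expect]
  | insert i s hi ih => simp only [Finset.sum_insert hi, expect_add, ih]

theorem toOuterMeasure_eq_expect (p : PMF α) (s : Set α) :
    p.toOuterMeasure s = expect p (s.indicator 1) := by
  rw [PMF.toOuterMeasure_apply, expect]
  refine tsum_congr fun a => ?_
  by_cases ha : a ∈ s <;> simp [ha]

/-- The law after `t` steps of the Markov chain with transition kernel `κ`, started at `a`. -/
def chain (κ : α → PMF α) (a : α) : ℕ → PMF α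
  | 0 => PMF.pure a
  | t + 1 => (chain κ a t).bind κ

variable {κ : α → PMF α} {a₀ : α} {I : α → Prop}

theorem chain_invariant (h0 : I a₀) (hI : ∀ a, I a → ∀ b ∈ (κ a).support, I b) (t : ℕ) :
    ∀ a ∈ (chain κ a₀ t).support, I a := by
  induction t with
  | zero =>
    intro a ha
    rw [chain, PMF.support_pure, Set.mem_singleton_iff] at ha
    rwa [ha]
  | succ t ih =>
    intro b hb
    rw [chain, PMF.mem_support_bind_iff] at hb
    obtain ⟨a, ha, hab⟩ := hb
    exact hI a (ih a ha) b hab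

theorem expect_chain_of_harmonic (h0 : I a₀) (hI : ∀ a, I a → ∀ b ∈ (κ a).support, I b)
    {h : α → ℝ≥0∞} (hh : ∀ a, I a → expect (κ a) h = h a) (t : ℕ) :
    expect (chain κ a₀ t) h = h a₀ := by
  induction t with
  | zero => rw [chain, expect_pure]
  | succ t ih =>
    rw [chain, expect_bind, ← ih]
    exact expect_congr fun a ha => hh a (chain_invariant h0 hI t a ha)

/-- Foster's argument: `h` pays for the cost `g` of each step in mean, so the partial sums of the
costs telescope. Finiteness of `h` is not required. -/
theorem sum_chain_le_of_potential (h0 : I a₀) (hI : ∀ a, I a → ∀ b ∈ (κ a).support, I b)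
    {h g : α → ℝ≥0∞} (hh : ∀ a, I a → g a + expect (κ a) h ≤ h a) :
    ∑' t, expect (chain κ a₀ t) g ≤ h a₀ := by
  have key : ∀ N, ∑ t ∈ Finset.range N, expect (chain κ a₀ t) g + expect (chain κ a₀ N) h
      ≤ h a₀ := by
    intro N
    induction N with
    | zero => simp [chain, expect_pure]
    | succ N ih =>
      refine le_trans ?_ ih
      rw [Finset.sum_range_succ, add_assoc]
      refine add_le_add_right ?_ _
      rw [chain, expect_bind, ← expect_add]
      exact expect_mono fun a ha => hh a (chain_invariant h0 hI N a ha)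
  refine ENNReal.tsum_le_of_sum_range_le fun N => le_trans le_self_add (key N)

/-- If `h` is a bounded harmonic function that agrees with the indicator of `A` on the absorbing
set `D`, and the chain is absorbed in `D`, then `h` gives the probability to be absorbed in `A`. -/
theorem iSup_chain_eq_of_harmonic (h0 : I a₀) (hI : ∀ a, I a → ∀ b ∈ (κ a).support, I b)
    {h : α → ℝ≥0∞} (hh : ∀ a, I a → expect (κ a) h = h a) {A D : Set α} (hAD : A ⊆ D)
    (hA : ∀ a, I a → a ∈ D → h a = A.indicator 1 a) {B : ℝ≥0∞} (hB : B ≠ ∞)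
    (hhB : ∀ a, I a → h a ≤ B)
    (hD : ∑' t, (chain κ a₀ t).toOuterMeasure Dᶜ ≠ ∞) :
    ⨆ t, (chain κ a₀ t).toOuterMeasure A = h a₀ := by
  apply le_antisymm
  · refine iSup_le fun t => ?_
    rw [← expect_chain_of_harmonic h0 hI hh t, toOuterMeasure_eq_expect]
    refine expect_mono fun a ha => ?_
    by_cases haA : a ∈ A
    · rw [hA a (chain_invariant h0 hI t a ha) (hAD haA)]
    · simp [haA]
  -- By harmonicity `h a₀` is the mean of `h` at time `t`, hence at most the probability of `A` at
  -- time `t` plus `B` times the probability of not being absorbed yet. The latter is summable in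
  -- `t`, so it tends to zero.
  · have hlim : Filter.Tendsto (fun t => (⨆ t, (chain κ a₀ t).toOuterMeasure A) +
        B * (chain κ a₀ t).toOuterMeasure Dᶜ) Filter.atTop
        (nhds ((⨆ t, (chain κ a₀ t).toOuterMeasure A) + B * 0)) := by
      refine tendsto_const_nhds.add (ENNReal.Tendsto.const_mul ?_ (Or.inr hB))
      exact ENNReal.tendsto_atTop_zero_of_tsum_ne_top hD
    rw [mul_zero, add_zero] at hlim
    refine ge_of_tendsto hlim (Filter.Eventually.of_forall fun t => ?_)
    refine le_trans ?_ (add_le_add_left (le_iSup _ t) _)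
    rw [← expect_chain_of_harmonic h0 hI hh t, toOuterMeasure_eq_expect,
      toOuterMeasure_eq_expect, ← expect_const_mul, ← expect_add]
    refine expect_mono fun a ha => ?_
    have hIa := chain_invariant h0 hI t a ha
    by_cases haD : a ∈ D
    · rw [hA a hIa haD]
      exact le_self_add
    · simpa [haD] using le_trans (hhB a hIa) le_add_self

/-- Monotonicity in time lets the supremum over `t` be exchanged with the finite sum over outputs in
`tsum_outputProb`. -/
theorem chain_monotone_of_absorbing {A : Set α} (hA : ∀ a ∈ A, κ a = PMF.pure a) :
    Monotone fun t => (chain κ a₀ t).toOuterMeasure A := by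
  refine monotone_nat_of_le_succ fun t => ?_
  rw [toOuterMeasure_eq_expect, toOuterMeasure_eq_expect, chain, expect_bind]
  refine expect_mono fun a _ => ?_
  by_cases ha : a ∈ A
  · rw [hA a ha, expect_pure]
  · simp [ha]

end Markov

/-! ## Sampling a uniform element -/

section Draw

variable {n : ℕ} {α : Type}

theorem expect_draw_of_nonempty {s : Finset α} (hs : s.Nonempty) (f : α → Config n) (c : Config n)
    (h : Config n → ℝ≥0∞) :
    expect (draw s f c) h = (∑ a ∈ s, h (f a)) / (s.card : ℝ≥0∞) := by
  rw [draw, dif_pos hs, expect_map, expect_uniformOfFinset]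
  rfl

theorem draw_empty (f : α → Config n) (c : Config n) :
    draw ∅ f c = PMF.pure c := by
  rw [draw, dif_neg Finset.not_nonempty_empty]

theorem mem_support_draw {s : Finset α} {f : α → Config n} {c b : Config n}
    (hb : b ∈ (draw s f c).support) : (s = ∅ ∧ b = c) ∨ ∃ a ∈ s, b = f a := by
  rcases s.eq_empty_or_nonempty with rfl | hs
  · left
    rw [draw_empty] at hb
    simpa using hb
  · right
    rw [draw, dif_pos hs, PMF.mem_support_map_iff] at hb
    obtain ⟨a, ha, rfl⟩ := hb
    exact ⟨a, by simpa using ha, rfl⟩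

/-- A real function averages to `x` over a uniform draw iff its sum is `x` times the number of
possibilities. -/
theorem expect_draw_ofReal_eq {s : Finset α} (hs : s.Nonempty) {f : α → Config n} {c : Config n}
    {h : Config n → ℝ} (h0 : ∀ a ∈ s, 0 ≤ h (f a)) {x : ℝ}
    (hx : ∑ a ∈ s, h (f a) = s.card * x) :
    expect (draw s f c) (fun c => ENNReal.ofReal (h c)) = ENNReal.ofReal x := by
  have hc : (0 : ℝ) < s.card := by exact_mod_cast hs.card_pos
  rw [expect_draw_of_nonempty hs, ← ENNReal.ofReal_sum_of_nonneg h0, hx, ← ENNReal.ofReal_natCast,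
    ← ENNReal.ofReal_div_of_pos hc, mul_div_cancel_left₀ _ hc.ne']

/-- Clearing the denominator moves the drift condition from `ℝ≥0∞` to a real inequality between
sums, where subtraction is harmless. -/
theorem one_add_expect_draw_ofReal_le {s : Finset α} (hs : s.Nonempty) {f : α → Config n}
    {c : Config n} {h : Config n → ℝ} (h0 : ∀ a ∈ s, 0 ≤ h (f a)) {x : ℝ}
    (hx : s.card + ∑ a ∈ s, h (f a) ≤ s.card * x) :
    1 + expect (draw s f c) (fun c => ENNReal.ofReal (h c)) ≤ ENNReal.ofReal x := by
  have hc : (0 : ℝ) < s.card := by exact_mod_cast hs.card_pos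
  rw [expect_draw_of_nonempty hs, ← ENNReal.ofReal_sum_of_nonneg h0, ← ENNReal.ofReal_natCast,
    ← ENNReal.ofReal_div_of_pos hc, ← ENNReal.ofReal_one,
    ← ENNReal.ofReal_add zero_le_one (div_nonneg (Finset.sum_nonneg h0) hc.le)]
  apply ENNReal.ofReal_le_ofReal
  rw [← sub_nonneg] at hx ⊢
  have : x - (1 + (∑ a ∈ s, h (f a)) / s.card) =
      (s.card * x - (s.card + ∑ a ∈ s, h (f a))) / s.card := by
    field_simp
  rw [this]
  exact div_nonneg hx hc.le

theorem one_add_ofReal_le {x y : ℝ} (hx : 0 ≤ x) (hxy : 1 + x ≤ y) :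
    1 + ENNReal.ofReal x ≤ ENNReal.ofReal y := by
  rw [← ENNReal.ofReal_one, ← ENNReal.ofReal_add zero_le_one hx]
  exact ENNReal.ofReal_le_ofReal hxy

end Draw

/-! ## Graphs given by lists of edges, and parent maps of trees -/

section Graphs

variable {V : Type}

/-- The graph whose edges are listed in `E`. -/
def edgeGraph (E : List (V × V)) : SimpleGraph V :=
  SimpleGraph.fromEdgeSet {e | ∃ p ∈ E, e = s(p.1, p.2)}

theorem edgeGraph_adj {E : List (V × V)} {a b : V} :
    (edgeGraph E).Adj a b ↔ ((a, b) ∈ E ∨ (b, a) ∈ E) ∧ a ≠ b := by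
  simp only [edgeGraph, SimpleGraph.fromEdgeSet_adj, Set.mem_ofPred_eq, Sym2.eq_iff, Prod.exists]
  refine and_congr_left fun _ => ⟨?_, ?_⟩
  · rintro ⟨x, y, h, ⟨rfl, rfl⟩ | ⟨rfl, rfl⟩⟩
    · exact Or.inl h
    · exact Or.inr h
  · rintro (h | h)
    · exact ⟨a, b, h, Or.inl ⟨rfl, rfl⟩⟩
    · exact ⟨b, a, h, Or.inr ⟨rfl, rfl⟩⟩

theorem edgeGraph_mono {E E' : List (V × V)} (h : E ⊆ E') : edgeGraph E ≤ edgeGraph E' := by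
  intro a b hab
  rw [edgeGraph_adj] at hab ⊢
  exact ⟨hab.1.imp (@h _) (@h _), hab.2⟩

theorem edgeGraph_le_iff {E : List (V × V)} {T : SimpleGraph V} (hE : ∀ e ∈ E, e.1 ≠ e.2) :
    edgeGraph E ≤ T ↔ ∀ e ∈ E, T.Adj e.1 e.2 := by
  constructor
  · intro h e he
    exact h (edgeGraph_adj.2 ⟨Or.inl he, hE e he⟩)
  · intro h a b hab
    rcases (edgeGraph_adj.1 hab).1 with h1 | h1
    · exact h _ h1
    · exact (h _ h1).symm

theorem ncard_edgeSet_edgeGraph_le (E : List (V × V)) :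
    (edgeGraph E).edgeSet.ncard ≤ E.length := by
  classical
  have hsub : (edgeGraph E).edgeSet ⊆ ((E.map fun e => s(e.1, e.2)).toFinset : Set (Sym2 V)) := by
    intro e he
    rw [edgeGraph, SimpleGraph.edgeSet_fromEdgeSet] at he
    obtain ⟨⟨p, hp, rfl⟩, _⟩ := he
    simp only [List.coe_toFinset, List.mem_map, Set.mem_ofPred_eq]
    exact ⟨p, hp, rfl⟩
  refine (Set.ncard_le_ncard hsub (Finset.finite_toSet _)).trans ?_
  rw [Set.ncard_coe_finset]
  exact (List.toFinset_card_le _).trans (by simp)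

/-- A connected graph has at least `|V| - 1` edges, and a list gives at most as many edges as its
length. So the list need not be checked for repeated edges. -/
theorem edgeGraph_isTree [Fintype V] [Nonempty V] {E : List (V × V)}
    (hr : ∀ a b, (edgeGraph E).Reachable a b) (hE : E.length + 1 = Fintype.card V) :
    (edgeGraph E).IsTree := by
  have hc : (edgeGraph E).Connected := ⟨hr⟩
  rw [SimpleGraph.isTree_iff_connected_and_card]
  refine ⟨hc, le_antisymm ?_ hc.card_vert_le_card_edgeSet_add_one⟩
  rw [Nat.card_eq_fintype_card (α := V), ← hE]
  exact Nat.succ_le_succ (ncard_edgeSet_edgeGraph_le E)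

theorem eq_of_le_of_isTree {G T : SimpleGraph V} (hG : G.IsTree) (hT : T.IsTree) (h : G ≤ T) :
    G = T :=
  SimpleGraph.isTree_iff_minimal_connected.1 hT |>.eq_of_ge hG.1 h |>.symm

/-- `p` maps every vertex of `T` other than the root `r` to the next vertex on the way to `r`. -/
structure ParentMap (T : SimpleGraph V) (r : V) (p : V → V) : Prop where
  root : p r = r
  adj_iff : ∀ a b, T.Adj a b ↔ (a ≠ r ∧ p a = b) ∨ (b ≠ r ∧ p b = a)
  rank : ∃ d : V → ℕ, ∀ v, v ≠ r → d (p v) < d v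

/-- The parent of `v` is the second vertex of the unique path from `v` to `r`, and the rank is the
length of that path. Across an edge, one of the two paths extends the other by this edge. -/
theorem exists_parentMap {T : SimpleGraph V} (hT : T.IsTree) (r : V) : ∃ p, ParentMap T r p := by
  classical
  choose P hP hu using fun v => hT.existsUnique_path v r
  have hmem : ∀ a b, T.Adj a b → b ∈ (P a).support → (P a).snd = b := fun a b hab hb =>
    (hT.2.eq_snd_of_adj_start (hP a) hab hb).symm
  have hne : ∀ v, v ≠ r → T.Adj v (P v).snd := fun v hv =>
    (P v).adj_snd (SimpleGraph.Walk.not_nil_of_ne hv)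
  refine ⟨fun v => (P v).snd, ?_, ?_, fun v => (P v).length, ?_⟩
  · have : P r = SimpleGraph.Walk.nil := (hu r _ SimpleGraph.Walk.IsPath.nil).symm
    simp [this]
  · intro a b
    constructor
    · intro hab
      by_cases hb : b ∈ (P a).support
      · left
        refine ⟨?_, hmem a b hab hb⟩
        rintro rfl
        have : P a = SimpleGraph.Walk.nil := (hu a _ SimpleGraph.Walk.IsPath.nil).symm
        rw [this] at hb
        simp at hb
        exact hab.ne hb.symm
      · right
        refine ⟨?_, ?_⟩
        · rintro rfl
          exact hb (P a).end_mem_support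
        · have : P b = SimpleGraph.Walk.cons hab.symm (P a) :=
            (hu b _ ((hP a).cons hb)).symm
          simp [this]
    · rintro (⟨ha, rfl⟩ | ⟨hb, rfl⟩)
      · exact hne a ha
      · exact (hne b hb).symm
  · intro v hv
    have hn : ¬ (P v).Nil := SimpleGraph.Walk.not_nil_of_ne hv
    have : P (P v).snd = (P v).tail := (hu _ _ (hP v).tail).symm
    have h2 := SimpleGraph.Walk.length_tail_add_one hn
    simp only
    rw [this]
    omega

/-- A set that contains the root and is connected by edges of the tree is closed under taking
parents. -/
theorem ParentMap.mem_of_reachable {T : SimpleGraph V} {r : V} {p : V → V} (hp : ParentMap T r p)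
    {E : List (V × V)} {S : Set V} (hE : ∀ e ∈ E, T.Adj e.1 e.2)
    (hS : ∀ e ∈ E, e.1 ∈ S ∧ e.2 ∈ S) {v : V} (hr : (edgeGraph E).Reachable v r)
    (hv : v ∈ S) : p v ∈ S := by
  by_cases hvr : v = r
  · rw [hvr, hp.root, ← hvr]
    exact hv
  obtain ⟨w⟩ := hr
  have hrD : ∀ k, p^[k] r ≠ v := by
    intro k
    rw [Function.iterate_fixed hp.root]
    exact Ne.symm hvr
  -- The set is the branch of `T` below `v`. It does not contain `r`, so the walk leaves it, and the
  -- only edge of `T` that leaves the branch joins `v` to `p v`. Hence `p v` is an end of a listed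
  -- edge.
  obtain ⟨d, -, hd1, hd2⟩ := w.exists_boundary_dart {x | ∃ k, p^[k] x = v} ⟨0, rfl⟩
    (fun ⟨k, hk⟩ => hrD k hk)
  have hadj := edgeGraph_adj.1 d.adj
  have hmemS : d.fst ∈ S ∧ d.snd ∈ S := by
    rcases hadj.1 with h | h
    · exact hS _ h
    · exact (hS _ h).symm
  have hT : T.Adj d.fst d.snd := by
    rcases hadj.1 with h | h
    · exact hE _ h
    · exact (hE _ h).symm
  obtain ⟨k, hk⟩ := hd1
  rcases (hp.adj_iff _ _).1 hT with ⟨_, h⟩ | ⟨_, h⟩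
  · cases k with
    | zero =>
      have hk' : d.fst = v := hk
      rw [← hk', h]
      exact hmemS.2
    | succ k =>
      rw [Function.iterate_succ_apply, h] at hk
      exact absurd ⟨k, hk⟩ hd2
  · refine absurd ⟨k + 1, ?_⟩ hd2
    rw [Function.iterate_succ_apply, h, hk]

end Graphs

/-! ## The invariant -/

section Invariant

variable {n : ℕ}

/-- The set `V_X`. -/
def treeSet (slot : Equiv.Perm (Fin n)) (free : Fin (n + 1)) : Finset (Fin n) :=
  Finset.univ.filter fun v => (free : ℕ) ≤ (slot.symm v : ℕ)

theorem mem_treeSet {slot : Equiv.Perm (Fin n)} {free : Fin (n + 1)} {v : Fin n} :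
    v ∈ treeSet slot free ↔ (free : ℕ) ≤ (slot.symm v : ℕ) := by
  simp [treeSet]

theorem inTree_iff (c : Config n) (v : Fin n) : c.inTree v ↔ v ∈ treeSet c.slot c.free := by
  simp [Config.inTree, treeSet]

theorem slot_notMem_treeSet {c : Config n} {i : Fin n} (hi : (i : ℕ) < c.free) :
    c.slot i ∉ treeSet c.slot c.free := by
  simpa [treeSet] using hi

theorem treeSet_eq_univ {c : Config n} (h : (c.free : ℕ) = 0) :
    treeSet c.slot c.free = Finset.univ := by
  simp [treeSet, h]

section AddVertex

variable (c : Config n) (v : Fin n)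

@[simp] theorem addVertex_phase : (c.addVertex v).phase = c.phase := by
  unfold Config.addVertex; split_ifs <;> rfl
@[simp] theorem addVertex_inV : (c.addVertex v).inV = c.inV := by
  unfold Config.addVertex; split_ifs <;> rfl
@[simp] theorem addVertex_inE : (c.addVertex v).inE = c.inE := by
  unfold Config.addVertex; split_ifs <;> rfl
@[simp] theorem addVertex_edges : (c.addVertex v).edges = c.edges := by
  unfold Config.addVertex; split_ifs <;> rfl
@[simp] theorem addVertex_path : (c.addVertex v).path = c.path := by
  unfold Config.addVertex; split_ifs <;> rfl
@[simp] theorem addVertex_mark : (c.addVertex v).mark = c.mark := by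
  unfold Config.addVertex; split_ifs <;> rfl
@[simp] theorem addVertex_label : (c.addVertex v).label = c.label := by
  unfold Config.addVertex; split_ifs <;> rfl
@[simp] theorem addVertex_out : (c.addVertex v).out = c.out := by
  unfold Config.addVertex; split_ifs <;> rfl

variable {c v}

theorem treeSet_addVertex (hv : v ∉ treeSet c.slot c.free) :
    treeSet (c.addVertex v).slot (c.addVertex v).free = insert v (treeSet c.slot c.free) := by
  have h : (c.slot.symm v : ℕ) < c.free := by simpa [treeSet] using hv
  have hfree := c.free.isLt
  ext w
  rw [Finset.mem_insert, mem_treeSet, mem_treeSet, Config.addVertex, dif_pos h]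
  have hw : w = v ↔ (c.slot.symm w) = c.slot.symm v := by simp
  rw [hw]
  simp only [Equiv.Perm.mul_def, Equiv.symm_trans_apply, Equiv.symm_swap, Equiv.swap_apply_def]
  split_ifs with h1 h2
  · simp [h1]
  · rw [Fin.ext_iff] at h2 h1 ⊢
    simp only at h2
    omega
  · rw [Fin.ext_iff] at h2 h1 ⊢
    simp only at h2
    omega

end AddVertex

/-- `vs` lists the vertices, and `es` the edges, of a tree. -/
structure TreeInput (vs : List (Fin n)) (es : List (Fin n × Fin n)) : Prop where
  nodup : vs.Nodup
  ne_nil : vs ≠ []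
  length : es.length + 1 = vs.length
  reachable : ∀ a ∈ vs, ∀ b ∈ vs, (edgeGraph es).Reachable a b
  mem : ∀ e ∈ es, e.1 ∈ vs ∧ e.2 ∈ vs
  ne : ∀ e ∈ es, e.1 ≠ e.2

/-- The loops of the path, the shuffle and the output have not been touched. -/
structure Fresh (c : Config n) : Prop where
  path : c.path = []
  mark : ∀ v, c.mark v = false
  label : c.label = 1
  out : c.out = []

/-- The state while the tree grows; the edges that were recorded so far span `S`. -/
structure Growing (vs : List (Fin n)) (es : List (Fin n × Fin n)) (c : Config n)
    (S : Finset (Fin n)) : Prop where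
  label : c.label = 1
  out : c.out = []
  nodup : c.path.Nodup
  outside : ∀ v ∈ c.path, v ∉ treeSet c.slot c.free
  mark : ∀ v, c.mark v = true ↔ v ∈ c.path
  subset : es ⊆ c.edges
  mem : ∀ v ∈ vs, v ∈ treeSet c.slot c.free
  reachable : ∀ a ∈ S, ∀ b ∈ S, (edgeGraph c.edges).Reachable a b
  length : c.edges.length + 1 = S.card
  ne : ∀ e ∈ c.edges, e.1 ≠ e.2
  -- This fixes the orientation: whenever `T` contains the recorded edges, an edge of `T` from a
  -- vertex outside `V_X` to a vertex of `S` must point towards `S`, since the parent of a vertex of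
  -- `S` is in `V_X`.
  closed : ∀ T r p, r ∈ vs → ParentMap T r p → (∀ e ∈ c.edges, T.Adj e.1 e.2) →
    ∀ v ∈ S, p v ∈ treeSet c.slot c.free

/-- The vertices of the tree and the first vertex of the path. -/
def headSet (K : Finset (Fin n)) : List (Fin n) → Finset (Fin n)
  | [] => K
  | v :: _ => insert v K

/-- The invariant of the procedure. -/
def Inv (vs : List (Fin n)) (es : List (Fin n × Fin n)) (c : Config n) : Prop :=
  match c.phase with
  | .init _ => Fresh c ∧ c.inV = vs ∧ c.inE = es ∧ c.edges = [] ∧ treeSet c.slot c.free = ∅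
  | .loadVertices => Fresh c ∧ c.inE = es ∧ c.edges = [] ∧
      ∃ pre, pre ++ c.inV = vs ∧ treeSet c.slot c.free = pre.toFinset
  | .loadEdges => Fresh c ∧ c.edges.reverse ++ c.inE = es ∧ treeSet c.slot c.free = vs.toFinset
  | .choose => c.path = [] ∧ Growing vs es c (treeSet c.slot c.free)
  | .walk => c.path ≠ [] ∧ Growing vs es c (treeSet c.slot c.free)
  | .erase u => u ∈ c.path ∧ Growing vs es c (treeSet c.slot c.free)
  -- The edge from the head of the path to the tree is recorded before the head enters `V_X`, so the
  -- edges span one vertex more than `V_X` until the path is exhausted.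
  | .attach => Growing vs es c (headSet (treeSet c.slot c.free) c.path)
  | .shuffle _ => c.out = [] ∧ c.edges.length + 1 = n ∧ (edgeGraph c.edges).IsTree
  | .relabel => (edgeGraph (c.edges.map (Prod.map c.label c.label) ++ c.out)).IsTree
  | .done => c.edges = [] ∧ (edgeGraph c.out).IsTree

end Invariant

/-! ## The steps in each phase -/

section Steps

variable {n : ℕ} {c : Config n}

theorem law_eq_chain (vs : List (Fin n)) (es : List (Fin n × Fin n)) (t : ℕ) :
    law vs es t = chain (step ⊤) (start vs es) t := by
  induction t with
  | zero => rfl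
  | succ t ih => rw [law, chain, ih]

theorem step_init_zero (h : c.phase = .init 0) :
    step ⊤ c = PMF.pure { c with phase := .loadVertices } := by
  unfold step; rw [h]

theorem step_init_succ {k : ℕ} (h : c.phase = .init (k + 1)) :
    step ⊤ c = PMF.pure { c with phase := .init k } := by
  unfold step; rw [h]

theorem step_loadVertices_nil (h : c.phase = .loadVertices) (hV : c.inV = []) :
    step ⊤ c = PMF.pure { c with phase := .loadEdges } := by
  unfold step; rw [h]; dsimp only; rw [hV]

theorem step_loadVertices_cons (h : c.phase = .loadVertices) {v : Fin n} {vs : List (Fin n)}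
    (hV : c.inV = v :: vs) : step ⊤ c = PMF.pure { c.addVertex v with inV := vs } := by
  unfold step; rw [h]; dsimp only; rw [hV]

theorem step_loadEdges_nil (h : c.phase = .loadEdges) (hE : c.inE = []) :
    step ⊤ c = PMF.pure { c with phase := .choose } := by
  unfold step; rw [h]; dsimp only; rw [hE]

theorem step_loadEdges_cons (h : c.phase = .loadEdges) {e : Fin n × Fin n}
    {es : List (Fin n × Fin n)} (hE : c.inE = e :: es) :
    step ⊤ c = PMF.pure { c with inE := es, edges := e :: c.edges } := by
  unfold step; rw [h]; dsimp only; rw [hE]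

/-- The state after the start of a walk at `v`. -/
def startWalk (c : Config n) (v : Fin n) : Config n :=
  { c with phase := .walk, path := [v], mark := Function.update c.mark v true }

theorem step_choose (h : c.phase = .choose) :
    step ⊤ c = draw (Finset.univ.filter fun i : Fin n => (i : ℕ) < (c.free : ℕ))
      (fun i => startWalk c (c.slot i)) { c with phase := .shuffle (Fin.last n) } := by
  unfold step; rw [h]; rfl

theorem filter_free_nonempty (h : (c.free : ℕ) ≠ 0) :
    (Finset.univ.filter fun i : Fin n => (i : ℕ) < (c.free : ℕ)).Nonempty :=
  ⟨⟨0, by omega⟩, by simpa using Nat.pos_of_ne_zero h⟩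

theorem step_choose_of_free_eq_zero (h : c.phase = .choose) (h0 : (c.free : ℕ) = 0) :
    step ⊤ c = PMF.pure { c with phase := .shuffle (Fin.last n) } := by
  rw [step_choose h]
  have : (Finset.univ.filter fun i : Fin n => (i : ℕ) < (c.free : ℕ)) = ∅ := by simp [h0]
  rw [this, draw_empty]

/-- The state after the walker has moved from `v`, the head of the path, to `u`. -/
def moveTo (c : Config n) (v u : Fin n) : Config n :=
  if u ∈ treeSet c.slot c.free then { c with phase := .attach, edges := (v, u) :: c.edges }
  else if c.mark u then { c with phase := .erase u }
  else { c with path := u :: c.path, mark := Function.update c.mark u true }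

theorem step_walk (h : c.phase = .walk) {v : Fin n} {rest : List (Fin n)} (hp : c.path = v :: rest) :
    step ⊤ c = draw (Finset.univ.erase v) (moveTo c v) c := by
  unfold step
  rw [h]
  dsimp only
  rw [hp]
  have h1 : (⊤ : SimpleGraph (Fin n)).neighborFinset v = Finset.univ.erase v := by
    ext u
    simp [eq_comm]
  dsimp only
  rw [h1]
  congr 1
  funext u
  simp only [moveTo, inTree_iff, hp, h]

theorem step_erase_self {u : Fin n} (h : c.phase = .erase u) {rest : List (Fin n)}
    (hp : c.path = u :: rest) : step ⊤ c = PMF.pure { c with phase := .walk } := by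
  unfold step; rw [h]; dsimp only; rw [hp]; simp

theorem step_erase_of_ne {u v : Fin n} (h : c.phase = .erase u) {rest : List (Fin n)}
    (hp : c.path = v :: rest) (hvu : v ≠ u) :
    step ⊤ c = PMF.pure { c with path := rest, mark := Function.update c.mark v false } := by
  unfold step; rw [h]; dsimp only; rw [hp]; simp [hvu]

theorem step_attach_nil (h : c.phase = .attach) (hp : c.path = []) :
    step ⊤ c = PMF.pure { c with phase := .choose } := by
  unfold step; rw [h]; dsimp only; rw [hp]

/-- The state after the head `v` of the path has been moved into the tree. -/
def attachHead (c : Config n) (v : Fin n) (rest : List (Fin n)) : Config n :=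
  { c.addVertex v with
    path := rest
    mark := Function.update c.mark v false
    edges := (rest.head?.map fun w => (w, v)).toList ++ c.edges }

theorem step_attach_cons (h : c.phase = .attach) {v : Fin n} {rest : List (Fin n)}
    (hp : c.path = v :: rest) : step ⊤ c = PMF.pure (attachHead c v rest) := by
  unfold step; rw [h]; dsimp only; rw [hp]
  cases rest with
  | nil => simp [attachHead]
  | cons w rest => rfl

/-- The state after one transposition of the shuffle. -/
def shuffleTo (c : Config n) (i : ℕ) (hi : i < n) (j : Fin n) : Config n :=
  { c with
    phase := .shuffle ⟨i, by omega⟩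
    label := c.label * Equiv.swap ⟨i, hi⟩ j }

theorem step_shuffle_succ {i : ℕ} (hi : i < n) (h : c.phase = .shuffle ⟨i + 1, by omega⟩) :
    step ⊤ c = draw (Finset.Iic (⟨i, hi⟩ : Fin n)) (shuffleTo c i hi) c := by
  unfold step; rw [h]; simp; rfl

theorem step_shuffle_zero (h : c.phase = .shuffle 0) :
    step ⊤ c = PMF.pure { c with phase := .relabel } := by
  unfold step; rw [h]; simp

theorem step_relabel_nil (h : c.phase = .relabel) (hE : c.edges = []) :
    step ⊤ c = PMF.pure { c with phase := .done } := by
  unfold step; rw [h]; dsimp only; rw [hE]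

theorem step_relabel_cons (h : c.phase = .relabel) {e : Fin n × Fin n} {es : List (Fin n × Fin n)}
    (hE : c.edges = e :: es) :
    step ⊤ c = PMF.pure { c with edges := es, out := e.map c.label c.label :: c.out } := by
  unfold step; rw [h]; dsimp only; rw [hE]; rfl

theorem step_done (h : c.phase = .done) : step ⊤ c = PMF.pure c := by
  unfold step; rw [h]

end Steps

/-! ## The invariant is preserved -/

section Preservation

variable {n : ℕ} {vs : List (Fin n)} {es : List (Fin n × Fin n)} {c : Config n}

theorem inv_start : Inv vs es (start vs es) := by
  refine ⟨⟨rfl, fun _ => rfl, rfl, rfl⟩, rfl, rfl, rfl, ?_⟩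
  ext v
  simp [mem_treeSet, start]

theorem inv_init_zero (h : c.phase = .init 0) (hI : Inv vs es c) :
    Inv vs es { c with phase := .loadVertices } := by
  simp only [Inv, h] at hI ⊢
  obtain ⟨hf, hV, hE, he, hs⟩ := hI
  exact ⟨⟨hf.path, hf.mark, hf.label, hf.out⟩, hE, he, [], by simpa using hV, by simpa using hs⟩

theorem inv_init_succ {k : ℕ} (h : c.phase = .init (k + 1)) (hI : Inv vs es c) :
    Inv vs es { c with phase := .init k } := by
  simp only [Inv, h] at hI ⊢
  obtain ⟨hf, hr⟩ := hI
  exact ⟨⟨hf.path, hf.mark, hf.label, hf.out⟩, hr⟩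

theorem inv_loadVertices_nil (h : c.phase = .loadVertices) (hV : c.inV = []) (hI : Inv vs es c) :
    Inv vs es { c with phase := .loadEdges } := by
  simp only [Inv, h] at hI ⊢
  obtain ⟨hf, hE, he, pre, hpre, hs⟩ := hI
  refine ⟨⟨hf.path, hf.mark, hf.label, hf.out⟩, by simp [he, hE], ?_⟩
  rw [hV, List.append_nil] at hpre
  rw [hs, hpre]

theorem notMem_of_loadVertices (hin : TreeInput vs es) (h : c.phase = .loadVertices) {v : Fin n}
    {l : List (Fin n)} (hV : c.inV = v :: l) (hI : Inv vs es c) : v ∉ treeSet c.slot c.free := by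
  simp only [Inv, h] at hI
  obtain ⟨hf, hE, he, pre, hpre, hs⟩ := hI
  rw [hs, List.mem_toFinset]
  intro hv
  have hn := hin.nodup
  rw [← hpre, hV] at hn
  exact (List.disjoint_of_nodup_append hn) hv List.mem_cons_self

theorem inv_loadVertices_cons (hin : TreeInput vs es) (h : c.phase = .loadVertices) {v : Fin n}
    {l : List (Fin n)} (hV : c.inV = v :: l) (hI : Inv vs es c) :
    Inv vs es { c.addVertex v with inV := l } := by
  have hv := notMem_of_loadVertices hin h hV hI
  simp only [Inv, h, addVertex_phase] at hI ⊢
  obtain ⟨hf, hE, he, pre, hpre, hs⟩ := hI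
  refine ⟨⟨by simp [hf.path], by simp [hf.mark], by simp [hf.label], by simp [hf.out]⟩,
    by simpa using hE, by simpa using he, pre ++ [v], by simpa [hV] using hpre, ?_⟩
  rw [treeSet_addVertex hv, hs]
  ext w
  simp

theorem growing_of_loadEdges (hin : TreeInput vs es) (h : c.phase = .loadEdges) (hE : c.inE = [])
    (hI : Inv vs es c) : Growing vs es c (treeSet c.slot c.free) := by
  simp only [Inv, h] at hI
  obtain ⟨hf, he, hs⟩ := hI
  rw [hE, List.append_nil] at he
  have hmem : ∀ e, e ∈ c.edges ↔ e ∈ es := fun e => by rw [← he, List.mem_reverse]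
  have hreach : ∀ a ∈ vs, ∀ b ∈ vs, (edgeGraph c.edges).Reachable a b := fun a ha b hb =>
    (hin.reachable a ha b hb).mono (edgeGraph_mono fun e => (hmem e).2)
  refine ⟨hf.label, hf.out, by simp [hf.path], by simp [hf.path], by simp [hf.path, hf.mark],
    fun e => (hmem e).2, by simp [hs], ?_, ?_, fun e h => hin.ne e ((hmem e).1 h), ?_⟩
  · intro a ha b hb
    rw [hs, List.mem_toFinset] at ha hb
    exact hreach a ha b hb
  · rw [hs, List.toFinset_card_of_nodup hin.nodup, ← hin.length, ← he, List.length_reverse]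
  -- Closure starts from the seed: it is connected by its own edges and contains the root.
  · intro T r p hr hp hT v hv
    rw [hs, List.mem_toFinset] at hv ⊢
    exact hp.mem_of_reachable (S := {v | v ∈ vs}) hT
      (fun e h => hin.mem e ((hmem e).1 h)) (hreach v hv r hr) hv

theorem inv_loadEdges_nil (hin : TreeInput vs es) (h : c.phase = .loadEdges) (hE : c.inE = [])
    (hI : Inv vs es c) : Inv vs es { c with phase := .choose } := by
  have hg := growing_of_loadEdges hin h hE hI
  simp only [Inv, h] at hI ⊢
  exact ⟨hI.1.path, ⟨hg.label, hg.out, hg.nodup, hg.outside, hg.mark, hg.subset, hg.mem,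
    hg.reachable, hg.length, hg.ne, hg.closed⟩⟩

theorem inv_loadEdges_cons (h : c.phase = .loadEdges) {e : Fin n × Fin n}
    {l : List (Fin n × Fin n)} (hE : c.inE = e :: l) (hI : Inv vs es c) :
    Inv vs es { c with inE := l, edges := e :: c.edges } := by
  simp only [Inv, h] at hI ⊢
  obtain ⟨hf, he, hs⟩ := hI
  refine ⟨⟨hf.path, hf.mark, hf.label, hf.out⟩, ?_, hs⟩
  rw [hE] at he
  simpa using he

theorem inv_startWalk (h : c.phase = .choose) (hI : Inv vs es c) {v : Fin n}
    (hv : v ∉ treeSet c.slot c.free) : Inv vs es (startWalk c v) := by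
  simp only [Inv, h, startWalk] at hI ⊢
  obtain ⟨hp, hg⟩ := hI
  refine ⟨by simp, ⟨hg.label, hg.out, by simp, by simpa using hv, ?_, hg.subset, hg.mem,
    hg.reachable, hg.length, hg.ne, hg.closed⟩⟩
  intro w
  have := hg.mark w
  rw [hp] at this
  by_cases hw : w = v
  · simp [hw]
  · simp only [Function.update_of_ne hw, this]
    simp [hw]

theorem inv_shuffle_last (hin : TreeInput vs es) (h : c.phase = .choose)
    (h0 : (c.free : ℕ) = 0) (hI : Inv vs es c) :
    Inv vs es { c with phase := .shuffle (Fin.last n) } := by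
  simp only [Inv, h] at hI ⊢
  obtain ⟨hp, hg⟩ := hI
  have hlen := hg.length
  have hr := hg.reachable
  simp only [treeSet_eq_univ h0, Finset.mem_univ, true_implies, Finset.card_univ,
    Fintype.card_fin] at hlen hr
  have : Nonempty (Fin n) := ⟨vs.head hin.ne_nil⟩
  exact ⟨hg.out, hlen, edgeGraph_isTree hr (by simpa using hlen)⟩

theorem inv_moveTo (h : c.phase = .walk) {v : Fin n} {rest : List (Fin n)}
    (hp : c.path = v :: rest) (hI : Inv vs es c) {u : Fin n} (huv : u ≠ v) :
    Inv vs es (moveTo c v u) := by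
  simp only [Inv, h] at hI
  obtain ⟨-, hg⟩ := hI
  have hvK : v ∉ treeSet c.slot c.free := hg.outside v (by simp [hp])
  unfold moveTo
  split_ifs with h1 h2
  · suffices H : Growing vs es { c with phase := .attach, edges := (v, u) :: c.edges }
        (insert v (treeSet c.slot c.free)) by
      simpa only [Inv, hp, headSet] using H
    have hle : edgeGraph c.edges ≤ edgeGraph ((v, u) :: c.edges) :=
      edgeGraph_mono (List.subset_cons_self _ _)
    have hvu : (edgeGraph ((v, u) :: c.edges)).Reachable v u :=
      (edgeGraph_adj.2 ⟨Or.inl List.mem_cons_self, huv.symm⟩ :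
        (edgeGraph ((v, u) :: c.edges)).Adj v u).reachable
    have hu : ∀ a ∈ insert v (treeSet c.slot c.free),
        (edgeGraph ((v, u) :: c.edges)).Reachable a u := by
      intro a ha
      rcases Finset.mem_insert.1 ha with rfl | ha
      · exact hvu
      · exact (hg.reachable a ha u h1).mono hle
    refine ⟨hg.label, hg.out, hg.nodup, hg.outside, hg.mark,
      fun e he => List.mem_cons_of_mem _ (hg.subset he), hg.mem,
      fun a ha b hb => (hu a ha).trans (hu b hb).symm, ?_, ?_, ?_⟩
    · rw [Finset.card_insert_of_notMem hvK, List.length_cons, hg.length]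
    · intro e he
      rcases List.mem_cons.1 he with rfl | he
      · exact huv.symm
      · exact hg.ne e he
    · intro T r p hr hpm hT w hw
      have hcl := hg.closed T r p hr hpm fun e he => hT e (List.mem_cons_of_mem _ he)
      rcases Finset.mem_insert.1 hw with rfl | hw
      -- The new edge joins the head to its parent `u`. The opposite orientation would make the head
      -- the parent of `u`, and closure at `u` would put the head into the tree.
      · rcases (hpm.adj_iff _ _).1 (hT _ List.mem_cons_self) with ⟨-, h3⟩ | ⟨-, h3⟩
        · exact (show p w = u from h3) ▸ h1
        · exact absurd ((show p u = w from h3) ▸ hcl u h1) hvK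
      · exact hcl w hw
  · simp only [Inv]
    exact ⟨(hg.mark u).1 h2, ⟨hg.label, hg.out, hg.nodup, hg.outside, hg.mark, hg.subset, hg.mem,
      hg.reachable, hg.length, hg.ne, hg.closed⟩⟩
  · have h3 : u ∉ c.path := fun h3 => h2 ((hg.mark u).2 h3)
    simp only [Inv, h]
    refine ⟨by simp, ⟨hg.label, hg.out, List.nodup_cons.2 ⟨h3, hg.nodup⟩, ?_, ?_, hg.subset,
      hg.mem, hg.reachable, hg.length, hg.ne, hg.closed⟩⟩
    · intro w hw
      rcases List.mem_cons.1 hw with rfl | hw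
      · exact h1
      · exact hg.outside w hw
    · intro w
      by_cases hw : w = u
      · simp [hw]
      · simp only [Function.update_of_ne hw, hg.mark]
        simp [hw]

theorem inv_erase_self {u : Fin n} (h : c.phase = .erase u) {rest : List (Fin n)}
    (hp : c.path = u :: rest) (hI : Inv vs es c) : Inv vs es { c with phase := .walk } := by
  simp only [Inv, h] at hI ⊢
  obtain ⟨-, hg⟩ := hI
  exact ⟨by simp [hp], ⟨hg.label, hg.out, hg.nodup, hg.outside, hg.mark, hg.subset, hg.mem,
    hg.reachable, hg.length, hg.ne, hg.closed⟩⟩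

theorem mark_update_tail {v : Fin n} {rest : List (Fin n)} {mark : Fin n → Bool}
    (hn : (v :: rest).Nodup) (hm : ∀ w, mark w = true ↔ w ∈ v :: rest) (w : Fin n) :
    Function.update mark v false w = true ↔ w ∈ rest := by
  by_cases hw : w = v
  · subst hw
    simpa using (List.nodup_cons.1 hn).1
  · rw [Function.update_of_ne hw, hm]
    simp [hw]

theorem inv_erase_of_ne {u v : Fin n} (h : c.phase = .erase u) {rest : List (Fin n)}
    (hp : c.path = v :: rest) (hvu : v ≠ u) (hI : Inv vs es c) :
    Inv vs es { c with path := rest, mark := Function.update c.mark v false } := by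
  simp only [Inv, h] at hI ⊢
  obtain ⟨hu, hg⟩ := hI
  have hn := hg.nodup
  have hm := hg.mark
  have ho := hg.outside
  rw [hp] at hu hn ho
  simp only [hp] at hm
  refine ⟨(List.mem_cons.1 hu).resolve_left hvu.symm, ⟨hg.label, hg.out, (List.nodup_cons.1 hn).2,
    fun w hw => ho w (List.mem_cons_of_mem _ hw), mark_update_tail hn hm, hg.subset, hg.mem,
    hg.reachable, hg.length, hg.ne, hg.closed⟩⟩

theorem inv_attach_nil (h : c.phase = .attach) (hp : c.path = []) (hI : Inv vs es c) :
    Inv vs es { c with phase := .choose } := by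
  simp only [Inv, h, hp, headSet] at hI ⊢
  exact ⟨trivial, ⟨hI.label, hI.out, by simp, by simp, by simpa [hp] using hI.mark, hI.subset,
    hI.mem, hI.reachable, hI.length, hI.ne, hI.closed⟩⟩

theorem inv_attachHead (h : c.phase = .attach) {v : Fin n} {rest : List (Fin n)}
    (hp : c.path = v :: rest) (hI : Inv vs es c) : Inv vs es (attachHead c v rest) := by
  simp only [Inv, h, hp, headSet] at hI
  have hn := hI.nodup
  have hm := hI.mark
  have ho := hI.outside
  rw [hp] at hn ho
  simp only [hp] at hm
  have hK := treeSet_addVertex (ho v List.mem_cons_self)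
  have ho' : ∀ w ∈ rest, w ∉ insert v (treeSet c.slot c.free) := by
    intro w hw h1
    rcases Finset.mem_insert.1 h1 with rfl | h1
    · exact (List.nodup_cons.1 hn).1 hw
    · exact ho w (List.mem_cons_of_mem _ hw) h1
  simp only [Inv, attachHead, addVertex_phase, h]
  rw [hK]
  cases rest with
  | nil =>
    simp only [headSet]
    refine ⟨by simp [hI.label], by simp [hI.out], by simp, by simp, ?_, by simpa using hI.subset,
      ?_, by simpa using hI.reachable, by simpa using hI.length, by simpa using hI.ne, ?_⟩
    · exact mark_update_tail hn hm
    · intro w hw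
      simp only [hK]
      exact Finset.mem_insert_of_mem (hI.mem w hw)
    · intro T r p hr hpm hT w hw
      simp only [hK]
      exact Finset.mem_insert_of_mem (hI.closed T r p hr hpm (by simpa using hT) w hw)
  | cons w rest =>
    have hwv : w ≠ v := fun h => (List.nodup_cons.1 hn).1 (h ▸ List.mem_cons_self)
    have hw := ho' w List.mem_cons_self
    have hle : edgeGraph c.edges ≤ edgeGraph ((w, v) :: c.edges) :=
      edgeGraph_mono (List.subset_cons_self _ _)
    have hadj : (edgeGraph ((w, v) :: c.edges)).Reachable w v :=
      (edgeGraph_adj.2 ⟨Or.inl List.mem_cons_self, hwv⟩ :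
        (edgeGraph ((w, v) :: c.edges)).Adj w v).reachable
    have hu : ∀ a ∈ insert w (insert v (treeSet c.slot c.free)),
        (edgeGraph ((w, v) :: c.edges)).Reachable a v := by
      intro a ha
      rcases Finset.mem_insert.1 ha with rfl | ha
      · exact hadj
      · exact (hI.reachable a ha v (Finset.mem_insert_self _ _)).mono hle
    simp only [headSet]
    refine ⟨by simp [hI.label], by simp [hI.out], (List.nodup_cons.1 hn).2, ?_, ?_,
      fun e he => List.mem_cons_of_mem _ (hI.subset he), ?_,
      fun a ha b hb => (hu a ha).trans (hu b hb).symm, ?_, ?_, ?_⟩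
    · simp only [hK]
      exact ho'
    · exact mark_update_tail hn hm
    · intro x hx
      simp only [hK]
      exact Finset.mem_insert_of_mem (hI.mem x hx)
    · rw [Finset.card_insert_of_notMem hw, ← hI.length]
      simp
    · intro e he
      rcases List.mem_cons.1 he with rfl | he
      · exact hwv
      · exact hI.ne e he
    · intro T r p hr hpm hT x hx
      simp only [hK]
      have hcl := hI.closed T r p hr hpm fun e he => hT e (List.mem_cons_of_mem _ he)
      rcases Finset.mem_insert.1 hx with rfl | hx
      · rcases (hpm.adj_iff _ _).1 (hT _ List.mem_cons_self) with ⟨-, h3⟩ | ⟨-, h3⟩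
        · exact (show p x = v from h3) ▸ Finset.mem_insert_self _ _
        · exact absurd ((show p v = x from h3) ▸ Finset.mem_insert_of_mem
            (hcl v (Finset.mem_insert_self _ _))) hw
      · exact Finset.mem_insert_of_mem (hcl x hx)

theorem inv_shuffleTo {k : Fin (n + 1)} (h : c.phase = .shuffle k) {i : ℕ} (hi : i < n)
    (j : Fin n) (hI : Inv vs es c) : Inv vs es (shuffleTo c i hi j) := by
  simp only [Inv, h, shuffleTo] at hI ⊢
  exact hI

/-- Relabelling the vertices by a permutation. -/
theorem edgeGraph_map_eq_comap (π : Equiv.Perm (Fin n)) (E : List (Fin n × Fin n)) :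
    edgeGraph (E.map (Prod.map π π)) = (edgeGraph E).comap π.symm := by
  ext a b
  simp only [edgeGraph_adj, List.mem_map, Prod.exists, Prod.map_apply, Prod.mk.injEq,
    SimpleGraph.comap_adj, ne_eq, EmbeddingLike.apply_eq_iff_eq]
  refine and_congr_left fun _ => or_congr ?_ ?_
  · constructor
    · rintro ⟨x, y, h, rfl, rfl⟩
      simpa using h
    · intro h
      exact ⟨_, _, h, by simp, by simp⟩
  · constructor
    · rintro ⟨x, y, h, rfl, rfl⟩
      simpa using h
    · intro h
      exact ⟨_, _, h, by simp, by simp⟩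

theorem inv_shuffle_zero (h : c.phase = .shuffle 0) (hI : Inv vs es c) :
    Inv vs es { c with phase := .relabel } := by
  simp only [Inv, h] at hI ⊢
  obtain ⟨ho, -, hT⟩ := hI
  rw [ho, List.append_nil, edgeGraph_map_eq_comap]
  exact (SimpleGraph.Iso.comap c.label.symm (edgeGraph c.edges)).isTree_iff.2 hT

theorem inv_relabel_nil (h : c.phase = .relabel) (hE : c.edges = []) (hI : Inv vs es c) :
    Inv vs es { c with phase := .done } := by
  simp only [Inv, h, hE, List.map_nil, List.nil_append] at hI ⊢
  exact ⟨trivial, hI⟩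

theorem edgeGraph_congr {V : Type} {E E' : List (V × V)} (h : ∀ e, e ∈ E ↔ e ∈ E') :
    edgeGraph E = edgeGraph E' :=
  le_antisymm (edgeGraph_mono fun e => (h e).1) (edgeGraph_mono fun e => (h e).2)

theorem edgeGraph_relabel_cons (e : Fin n × Fin n) (l out : List (Fin n × Fin n))
    (π : Equiv.Perm (Fin n)) :
    edgeGraph (l.map (Prod.map π π) ++ e.map π π :: out) =
      edgeGraph ((e :: l).map (Prod.map π π) ++ out) := by
  refine edgeGraph_congr fun x => ?_
  simp only [List.mem_append, List.mem_cons, List.map_cons]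
  tauto

theorem inv_relabel_cons (h : c.phase = .relabel) {e : Fin n × Fin n}
    {l : List (Fin n × Fin n)} (hE : c.edges = e :: l) (hI : Inv vs es c) :
    Inv vs es { c with edges := l, out := e.map c.label c.label :: c.out } := by
  simp only [Inv, h] at hI ⊢
  rw [edgeGraph_relabel_cons, ← hE]
  exact hI

theorem inv_step (hin : TreeInput vs es) (c : Config n) (hI : Inv vs es c) :
    ∀ b ∈ (step ⊤ c).support, Inv vs es b := by
  intro b hb
  cases h : c.phase with
  | init k =>
    cases k with
    | zero =>
      rw [step_init_zero h, PMF.mem_support_pure_iff] at hb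
      exact hb ▸ inv_init_zero h hI
    | succ k =>
      rw [step_init_succ h, PMF.mem_support_pure_iff] at hb
      exact hb ▸ inv_init_succ h hI
  | loadVertices =>
    cases hV : c.inV with
    | nil =>
      rw [step_loadVertices_nil h hV, PMF.mem_support_pure_iff] at hb
      exact hb ▸ inv_loadVertices_nil h hV hI
    | cons v l =>
      rw [step_loadVertices_cons h hV, PMF.mem_support_pure_iff] at hb
      exact hb ▸ inv_loadVertices_cons hin h hV hI
  | loadEdges =>
    cases hE : c.inE with
    | nil =>
      rw [step_loadEdges_nil h hE, PMF.mem_support_pure_iff] at hb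
      exact hb ▸ inv_loadEdges_nil hin h hE hI
    | cons e l =>
      rw [step_loadEdges_cons h hE, PMF.mem_support_pure_iff] at hb
      exact hb ▸ inv_loadEdges_cons h hE hI
  | choose =>
    by_cases h0 : (c.free : ℕ) = 0
    · rw [step_choose_of_free_eq_zero h h0, PMF.mem_support_pure_iff] at hb
      exact hb ▸ inv_shuffle_last hin h h0 hI
    · rw [step_choose h] at hb
      rcases mem_support_draw hb with ⟨h1, -⟩ | ⟨i, hi, rfl⟩
      · exact absurd h1 (filter_free_nonempty h0).ne_empty
      · exact inv_startWalk h hI (slot_notMem_treeSet (by simpa using hi))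
  | walk =>
    cases hp : c.path with
    | nil =>
      simp only [Inv, h] at hI
      exact absurd hp hI.1
    | cons v rest =>
      rw [step_walk h hp] at hb
      rcases mem_support_draw hb with ⟨-, rfl⟩ | ⟨u, hu, rfl⟩
      · exact hI
      · exact inv_moveTo h hp hI (Finset.mem_erase.1 hu).1
  | erase u =>
    cases hp : c.path with
    | nil =>
      simp only [Inv, h, hp] at hI
      exact absurd hI.1 List.not_mem_nil
    | cons v rest =>
      by_cases hvu : v = u
      · subst hvu
        rw [step_erase_self h hp, PMF.mem_support_pure_iff] at hb
        exact hb ▸ inv_erase_self h hp hI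
      · rw [step_erase_of_ne h hp hvu, PMF.mem_support_pure_iff] at hb
        exact hb ▸ inv_erase_of_ne h hp hvu hI
  | attach =>
    cases hp : c.path with
    | nil =>
      rw [step_attach_nil h hp, PMF.mem_support_pure_iff] at hb
      exact hb ▸ inv_attach_nil h hp hI
    | cons v rest =>
      rw [step_attach_cons h hp, PMF.mem_support_pure_iff] at hb
      exact hb ▸ inv_attachHead h hp hI
  | shuffle k =>
    obtain ⟨k, hk⟩ := k
    cases k with
    | zero =>
      rw [step_shuffle_zero h, PMF.mem_support_pure_iff] at hb
      exact hb ▸ inv_shuffle_zero h hI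
    | succ i =>
      rw [step_shuffle_succ (by omega) h] at hb
      rcases mem_support_draw hb with ⟨-, rfl⟩ | ⟨j, -, rfl⟩
      · exact hI
      · exact inv_shuffleTo h _ j hI
  | relabel =>
    cases hE : c.edges with
    | nil =>
      rw [step_relabel_nil h hE, PMF.mem_support_pure_iff] at hb
      exact hb ▸ inv_relabel_nil h hE hI
    | cons e l =>
      rw [step_relabel_cons h hE, PMF.mem_support_pure_iff] at hb
      exact hb ▸ inv_relabel_cons h hE hI
  | done =>
    rw [step_done h, PMF.mem_support_pure_iff] at hb
    exact hb ▸ hI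

end Preservation

/-! ## Sums over the possible moves of the walker -/

section Moves

variable {n : ℕ} {vs : List (Fin n)} {es : List (Fin n × Fin n)} {c : Config n}

/-- The sum of `G` over the non-empty suffixes of a list. -/
def sumSuffix {α : Type} (G : List α → ℝ) : List α → ℝ
  | [] => 0
  | a :: l => G (a :: l) + sumSuffix G l

theorem dropWhile_ne_cons_of_ne {a u : Fin n} (l : List (Fin n)) (h : a ≠ u) :
    (a :: l).dropWhile (· ≠ u) = l.dropWhile (· ≠ u) := by
  simp [h]

theorem dropWhile_ne_cons_self (u : Fin n) (l : List (Fin n)) :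
    (u :: l).dropWhile (· ≠ u) = u :: l := by
  simp

/-- Erasing the loop closed at `u` leaves the suffix of the path that starts at `u`. As the path has
no repetition, its vertices correspond to its non-empty suffixes. -/
theorem sum_dropWhile_eq_sumSuffix (G : List (Fin n) → ℝ) {l : List (Fin n)} (hl : l.Nodup) :
    ∑ u ∈ l.toFinset, G (l.dropWhile (· ≠ u)) = sumSuffix G l := by
  induction l with
  | nil => simp [sumSuffix]
  | cons a l ih =>
    obtain ⟨ha, hl⟩ := List.nodup_cons.1 hl
    rw [List.toFinset_cons, Finset.sum_insert (by simpa using ha), dropWhile_ne_cons_self,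
      sumSuffix, ← ih hl]
    congr 1
    refine Finset.sum_congr rfl fun u hu => ?_
    rw [dropWhile_ne_cons_of_ne]
    rintro rfl
    exact ha (by simpa using hu)

/-- The vertices that are neither in the tree nor on the path. -/
def newSet (c : Config n) : Finset (Fin n) :=
  Finset.univ.filter fun u => u ∉ treeSet c.slot c.free ∧ u ∉ c.path

variable {v : Fin n} {rest : List (Fin n)}

theorem card_newSet {S : Finset (Fin n)} (hg : Growing vs es c S) :
    (treeSet c.slot c.free).card + c.path.length + (newSet c).card = n := by
  have h1 : Disjoint (treeSet c.slot c.free) c.path.toFinset :=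
    Finset.disjoint_right.2 fun u hu => hg.outside u (by simpa using hu)
  have h2 : newSet c = (treeSet c.slot c.free ∪ c.path.toFinset)ᶜ := by
    ext u; simp [newSet]
  rw [← List.toFinset_card_of_nodup hg.nodup, ← Finset.card_union_of_disjoint h1, h2,
    Finset.card_add_card_compl, Fintype.card_fin]

theorem Growing.one_le_card {S : Finset (Fin n)} (hin : TreeInput vs es) (hg : Growing vs es c S) :
    1 ≤ (treeSet c.slot c.free).card :=
  Finset.card_pos.2 ⟨vs.head hin.ne_nil, hg.mem _ (List.head_mem _)⟩

/-- The neighbours of the head `v` split by what happens next: the walk hits the tree, closes a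
loop, or lengthens the path. -/
theorem sum_moves {S : Finset (Fin n)} (hg : Growing vs es c S) (hp : c.path = v :: rest)
    (f : Fin n → ℝ) :
    ∑ u ∈ Finset.univ.erase v, f u = ∑ u ∈ treeSet c.slot c.free, f u +
      ∑ u ∈ rest.toFinset, f u + ∑ u ∈ newSet c, f u := by
  have hn := hg.nodup
  have ho := hg.outside
  rw [hp] at hn ho
  have h1 : Disjoint (treeSet c.slot c.free) rest.toFinset :=
    Finset.disjoint_right.2 fun u hu => ho u (List.mem_cons_of_mem _ (by simpa using hu))
  have h2 : Disjoint (treeSet c.slot c.free ∪ rest.toFinset) (newSet c) := by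
    refine Finset.disjoint_right.2 fun u hu => ?_
    simp only [newSet, hp, Finset.mem_filter, Finset.mem_univ, true_and, List.mem_cons,
      not_or] at hu
    simp [hu.1, hu.2.2]
  rw [← Finset.sum_union h1, ← Finset.sum_union h2]
  congr 1
  ext u
  simp only [newSet, hp, Finset.mem_erase, Finset.mem_univ, and_true, Finset.mem_union,
    List.mem_toFinset, Finset.mem_filter, true_and, List.mem_cons, not_or]
  constructor
  · intro h
    tauto
  · rintro ((h | h) | h) rfl
    · exact ho u List.mem_cons_self h
    · exact (List.nodup_cons.1 hn).1 h
    · exact h.2.1 rfl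

theorem moveTo_of_mem_treeSet {u : Fin n} (hu : u ∈ treeSet c.slot c.free) :
    moveTo c v u = { c with phase := .attach, edges := (v, u) :: c.edges } := if_pos hu

theorem moveTo_of_mem_rest {S : Finset (Fin n)} (hg : Growing vs es c S) (hp : c.path = v :: rest)
    {u : Fin n} (hu : u ∈ rest) : moveTo c v u = { c with phase := .erase u } := by
  have h1 : u ∈ c.path := by rw [hp]; exact List.mem_cons_of_mem _ hu
  rw [moveTo, if_neg (hg.outside u h1), if_pos ((hg.mark u).2 h1)]

theorem moveTo_of_mem_newSet {S : Finset (Fin n)} (hg : Growing vs es c S) {u : Fin n}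
    (hu : u ∈ newSet c) : moveTo c v u =
      { c with path := u :: c.path, mark := Function.update c.mark u true } := by
  obtain ⟨h1, h2⟩ : u ∉ treeSet c.slot c.free ∧ u ∉ c.path := by simpa [newSet] using hu
  rw [moveTo, if_neg h1, if_neg fun h => h2 ((hg.mark u).1 h)]

theorem dropWhile_path_of_mem_rest {S : Finset (Fin n)} (hg : Growing vs es c S)
    (hp : c.path = v :: rest) {u : Fin n} (hu : u ∈ rest) :
    c.path.dropWhile (· ≠ u) = rest.dropWhile (· ≠ u) := by
  have hn := hg.nodup
  rw [hp] at hn ⊢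
  exact dropWhile_ne_cons_of_ne _ fun h => (List.nodup_cons.1 hn).1 (h ▸ hu)

theorem card_moves (v : Fin n) : ((Finset.univ.erase v).card : ℝ) = (n : ℝ) - 1 := by
  rw [Finset.card_erase_of_mem (Finset.mem_univ _), Finset.card_univ, Fintype.card_fin,
    Nat.cast_sub (by have := v.isLt; omega), Nat.cast_one]

/-- The seed supplies a vertex other than the head, so the fallback of `draw` for an empty set is
never used in the walk. -/
theorem moves_nonempty {S : Finset (Fin n)} (hin : TreeInput vs es) (hg : Growing vs es c S)
    (hp : c.path = v :: rest) : (Finset.univ.erase v).Nonempty := by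
  refine ⟨vs.head hin.ne_nil, Finset.mem_erase.2 ⟨fun h => ?_, Finset.mem_univ _⟩⟩
  exact hg.outside v (by simp [hp]) (h ▸ hg.mem _ (List.head_mem _))

end Moves

/-! ## The running time -/

section RunningTime

variable {n : ℕ} {vs : List (Fin n)} {es : List (Fin n × Fin n)} {c : Config n}

/-- The expected number of walk steps, divided by `n - 1`, until all vertices are in the tree, if
the tree has `k` vertices and the path has `m + 1`. -/
def walkTime (n k m : ℕ) : ℝ :=
  1 / k + (n - k - 1) / n - k / n * ∑ i ∈ Finset.range m, 1 / ((k : ℝ) + 1 + i)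

/-- The term with index `i` occurs `m - 1 - i = (k + m) - (k + 1 + i)` times. -/
theorem sum_sum_inv (k : ℕ) (m : ℕ) :
    ∑ j ∈ Finset.range m, ∑ i ∈ Finset.range j, 1 / ((k : ℝ) + 1 + i) =
      (k + m) * ∑ i ∈ Finset.range m, 1 / ((k : ℝ) + 1 + i) - m := by
  induction m with
  | zero => simp
  | succ m ih =>
    rw [Finset.sum_range_succ, ih, Finset.sum_range_succ]
    have : (k : ℝ) + 1 + m ≠ 0 := by positivity
    push_cast
    field_simp
    ring

/-- First-step analysis: `k` moves reach the tree, which then gains `m + 1` vertices; `m` moves cut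
the path back to `j + 1` vertices with `j < m`; the others lengthen it. For `m = 0` the solution is
`(n - k) * (k + 1) / (n * k)`, which is the trace of the Green function of the walk killed on the
tree, divided by `n - 1`. -/
theorem walkTime_recurrence {n k m : ℕ} (hn : 0 < n) (hk : 0 < k) :
    k * walkTime n (k + m + 1) 0 + ∑ j ∈ Finset.range m, walkTime n k j +
      ((n : ℝ) - k - (m + 1)) * walkTime n k (m + 1) = (n - 1) * walkTime n k m - 1 := by
  have h1 : (n : ℝ) ≠ 0 := by positivity
  have h2 : (k : ℝ) ≠ 0 := by positivity
  have h3 : (k : ℝ) + m + 1 ≠ 0 := by positivity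
  have h4 : (k : ℝ) + 1 + m ≠ 0 := by positivity
  have h5 : ∑ j ∈ Finset.range m, walkTime n k j = m * (1 / k + (n - k - 1) / n) -
      k / n * ((k + m) * ∑ i ∈ Finset.range m, 1 / ((k : ℝ) + 1 + i) - m) := by
    simp only [walkTime, Finset.sum_sub_distrib, ← Finset.mul_sum, sum_sum_inv, Finset.sum_const,
      Finset.card_range, nsmul_eq_mul]
  rw [h5]
  simp only [walkTime, Finset.sum_range_succ, Finset.range_zero, Finset.sum_empty]
  generalize ∑ i ∈ Finset.range m, 1 / ((k : ℝ) + 1 + i) = s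
  push_cast
  field_simp
  ring

/-- Each term `k / (k + 1 + i)` is at most one, so the subtracted sum is at most `m / n`, which the
second summand of `walkTime` covers because `m ≤ n - k - 1`. -/
theorem walkTime_nonneg {n k m : ℕ} (hk : 0 < k) (h : k + m + 1 ≤ n) : 0 ≤ walkTime n k m := by
  have hn : (0 : ℝ) < n := by exact_mod_cast (by omega : 0 < n)
  have hk' : (0 : ℝ) < k := by exact_mod_cast hk
  have h1 : k * ∑ i ∈ Finset.range m, 1 / ((k : ℝ) + 1 + i) ≤ m := by
    rw [Finset.mul_sum]
    refine (Finset.sum_le_card_nsmul _ _ 1 fun i _ => ?_).trans (by simp)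
    rw [mul_one_div, div_le_one (by positivity)]
    have : (0 : ℝ) ≤ i := Nat.cast_nonneg i
    linarith
  have h2 : (k : ℝ) + m + 1 ≤ n := by exact_mod_cast h
  have h3 : walkTime n k m = 1 / k + ((n - k - 1) -
      k * ∑ i ∈ Finset.range m, 1 / ((k : ℝ) + 1 + i)) / n := by
    rw [walkTime]; ring
  rw [h3]
  have h4 : (0 : ℝ) ≤ (n - k - 1) - k * ∑ i ∈ Finset.range m, 1 / ((k : ℝ) + 1 + i) := by linarith
  positivity

theorem walkTime_self {n : ℕ} (hn : 0 < n) : walkTime n n 0 = 0 := by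
  have : (n : ℝ) ≠ 0 := by positivity
  simp only [walkTime, Finset.range_zero, Finset.sum_empty]
  field_simp
  ring

theorem walkTime_zero_nonneg {n k : ℕ} (hk : 0 < k) (h : k ≤ n) : 0 ≤ walkTime n k 0 := by
  rcases h.lt_or_eq with h | rfl
  · exact walkTime_nonneg hk h
  · exact (walkTime_self hk).ge

/-- A bound for the expected number of steps from the choice of a starting vertex, if the tree has
`k` vertices. -/
def choosePotential (n k : ℕ) : ℝ :=
  -- The first `2 * n + 2` pay for everything after the growth of the tree. Each walk step gets two
  -- units, one for itself and one for the removal of the vertex that it pushes, or for the end of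
  -- the erasure that it starts. The last term covers the fixed overhead of the remaining walks, of
  -- which there are at most `n - k`.
  2 * n + 2 + 2 * (n - 1) * walkTime n k 0 + 2 * (n - k)

/-- A bound for the expected number of steps from a configuration in the walk, if the tree has `k`
vertices and the path has `m + 1`. -/
def walkPotential (n k m : ℕ) : ℝ :=
  -- The final `m + 1` is the credit stored on the path, one unit per vertex, for its later removal.
  2 * n + 2 * (n - 1) * walkTime n k m + 2 * (n - k) + m + 1

/-- A bound for the expected number of steps from a configuration, if the input tree has `k`
vertices. -/
def potential (k : ℕ) (c : Config n) : ℝ :=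
  match c.phase with
  | .init j => j + 1 + (c.inV.length + 1) + (c.inE.length + 1) + choosePotential n k
  | .loadVertices => (c.inV.length + 1) + (c.inE.length + 1) + choosePotential n k
  | .loadEdges => (c.inE.length + 1) + choosePotential n k
  | .choose => choosePotential n (treeSet c.slot c.free).card
  | .walk => walkPotential n (treeSet c.slot c.free).card (c.path.length - 1)
  -- What remains is one step for each vertex above `u`, one step to resume the walk, and the walk
  -- from the shortened path.
  | .erase u => walkPotential n (treeSet c.slot c.free).card
      ((c.path.dropWhile (· ≠ u)).length - 1) + c.path.length -
      (c.path.dropWhile (· ≠ u)).length + 1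
  | .attach => choosePotential n ((treeSet c.slot c.free).card + c.path.length) +
      c.path.length + 1
  | .shuffle i => (i : ℕ) + c.edges.length + 2
  | .relabel => c.edges.length + 1
  | .done => 0

theorem choosePotential_nonneg {k : ℕ} (hk : 0 < k) (h : k ≤ n) : 0 ≤ choosePotential n k := by
  have h1 := walkTime_zero_nonneg hk h
  have h2 : (k : ℝ) ≤ n := by exact_mod_cast h
  have h3 : (0 : ℝ) ≤ (n : ℝ) - 1 := by
    have : (1 : ℝ) ≤ n := by exact_mod_cast (by omega : 1 ≤ n)
    linarith
  have := mul_nonneg h3 h1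
  unfold choosePotential
  linarith

theorem walkPotential_nonneg {k m : ℕ} (hk : 0 < k) (h : k + m + 1 ≤ n) :
    0 ≤ walkPotential n k m := by
  have h1 := walkTime_nonneg hk h
  have h2 : (k : ℝ) + m + 1 ≤ n := by exact_mod_cast h
  have h3 : (0 : ℝ) ≤ (n : ℝ) - 1 := by
    have : (1 : ℝ) ≤ n := by exact_mod_cast (by omega : 1 ≤ n)
    linarith
  have h4 : (0 : ℝ) ≤ m := Nat.cast_nonneg m
  have := mul_nonneg h3 h1
  unfold walkPotential
  linarith

theorem TreeInput.length_pos (hin : TreeInput vs es) : 0 < vs.length :=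
  List.length_pos_iff.2 hin.ne_nil

theorem TreeInput.length_le (hin : TreeInput vs es) : vs.length ≤ n := by
  simpa using hin.nodup.length_le_card

theorem potential_nonneg (hin : TreeInput vs es) (hI : Inv vs es c) :
    0 ≤ potential vs.length c := by
  have h0 := choosePotential_nonneg hin.length_pos hin.length_le
  cases h : c.phase with
  | init j => simp only [potential, h]; positivity
  | loadVertices => simp only [potential, h]; positivity
  | loadEdges => simp only [potential, h]; positivity
  | choose =>
    simp only [Inv, h] at hI
    have h1 := card_newSet hI.2
    simp only [potential, h]
    exact choosePotential_nonneg (hI.2.one_le_card hin) (by omega)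
  | walk =>
    simp only [Inv, h] at hI
    have h1 := card_newSet hI.2
    have h2 := List.length_pos_iff.2 hI.1
    simp only [potential, h]
    exact walkPotential_nonneg (hI.2.one_le_card hin) (by omega)
  | erase u =>
    simp only [Inv, h] at hI
    have h1 := card_newSet hI.2
    have h2 := List.length_pos_iff.2 (List.ne_nil_of_mem hI.1)
    have h3 : (c.path.dropWhile (· ≠ u)).length ≤ c.path.length :=
      (List.dropWhile_sublist _).length_le
    have h4 : ((c.path.dropWhile (· ≠ u)).length : ℝ) ≤ c.path.length := by exact_mod_cast h3
    have h5 := walkPotential_nonneg (n := n) (m := (c.path.dropWhile (· ≠ u)).length - 1)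
      (hI.2.one_le_card hin) (by omega)
    simp only [potential, h]
    linarith
  | attach =>
    simp only [Inv, h] at hI
    have h1 := card_newSet hI
    have h2 := hI.one_le_card hin
    have h3 := choosePotential_nonneg (n := n) (k := (treeSet c.slot c.free).card + c.path.length)
      (by omega) (by omega)
    simp only [potential, h]
    positivity
  | shuffle i => simp only [potential, h]; positivity
  | relabel => simp only [potential, h]; positivity
  | done => simp only [potential, h]; exact le_rfl

theorem one_add_expect_pure_le (hin : TreeInput vs es) (hI : Inv vs es c) {b : Config n}
    (hs : step ⊤ c = PMF.pure b) (hb : 1 + potential vs.length b ≤ potential vs.length c) :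
    1 + expect (step ⊤ c) (fun c => ENNReal.ofReal (potential vs.length c)) ≤
      ENNReal.ofReal (potential vs.length c) := by
  rw [hs, expect_pure]
  refine one_add_ofReal_le (potential_nonneg hin (inv_step hin c hI b ?_)) hb
  rw [hs]
  simp

theorem potential_startWalk {k : ℕ} (h : c.phase = .choose) (v : Fin n) :
    1 + potential k (startWalk c v) = potential k c := by
  simp only [potential, startWalk, h, walkPotential, choosePotential]
  simp
  ring

/-- The terms with `walkTime` are governed by `walkTime_recurrence`, and its `-1` multiplied by `2 *
(n - 1)` leaves two units per move. One pays for the step. The other is what a push or a loop adds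
to the rest of the potential; a hit of the tree adds no more. -/
theorem sum_potential_moveTo_le {k : ℕ} (hin : TreeInput vs es) (h : c.phase = .walk) {v : Fin n}
    {rest : List (Fin n)} (hp : c.path = v :: rest)
    (hg : Growing vs es c (treeSet c.slot c.free)) :
    ((n : ℝ) - 1) + ∑ u ∈ Finset.univ.erase v, potential k (moveTo c v u) ≤
      (n - 1) * potential k c := by
  have hcard := card_newSet hg
  have hk := hg.one_le_card hin
  rw [hp, List.length_cons] at hcard
  have hcard' : ((newSet c).card : ℝ) =
      n - (treeSet c.slot c.free).card - (rest.length + 1) := by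
    rw [eq_sub_iff_add_eq, eq_sub_iff_add_eq]
    exact_mod_cast (by omega)
  set K := (treeSet c.slot c.free).card with hK
  rw [sum_moves hg hp]
  have e1 : ∑ u ∈ treeSet c.slot c.free, potential k (moveTo c v u) =
      K * (choosePotential n (K + rest.length + 1) + rest.length + 2) := by
    rw [Finset.sum_congr rfl fun u hu => by rw [moveTo_of_mem_treeSet hu], hK, ← nsmul_eq_mul,
      ← Finset.sum_const]
    refine Finset.sum_congr rfl fun u hu => ?_
    simp only [potential, hp, List.length_cons]
    push_cast
    rw [add_assoc K]
    ring
  have e2 : ∑ u ∈ rest.toFinset, potential k (moveTo c v u) =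
      sumSuffix (fun l => walkPotential n K (l.length - 1) + (rest.length + 1) - l.length + 1)
        rest := by
    have hn := hg.nodup
    rw [hp] at hn
    rw [← sum_dropWhile_eq_sumSuffix _ (List.nodup_cons.1 hn).2]
    refine Finset.sum_congr rfl fun u hu => ?_
    have hu' : u ∈ rest := by simpa using hu
    rw [moveTo_of_mem_rest hg hp hu']
    simp only [potential, dropWhile_path_of_mem_rest hg hp hu']
    rw [hp, List.length_cons]
    push_cast
    rfl
  have e3 : ∑ u ∈ newSet c, potential k (moveTo c v u) =
      (newSet c).card * walkPotential n K (rest.length + 1) := by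
    rw [← nsmul_eq_mul, ← Finset.sum_const]
    refine Finset.sum_congr rfl fun u hu => ?_
    rw [moveTo_of_mem_newSet hg hu]
    simp [potential, h, hp, hK]
  have e4 : ∀ l : List (Fin n), ∀ x : ℝ,
      sumSuffix (fun l => walkPotential n K (l.length - 1) + x - l.length + 1) l =
      ∑ j ∈ Finset.range l.length, (walkPotential n K j + x - j) := by
    intro l x
    induction l with
    | nil => simp [sumSuffix]
    | cons a l ih =>
      rw [sumSuffix, ih, List.length_cons, Finset.sum_range_succ]
      simp
      ring
  have hrec := walkTime_recurrence (n := n) (m := rest.length) (by omega : 0 < n)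
    (by omega : 0 < K)
  rw [e1, e2, e4, e3, hcard']
  have hpc : potential k c = walkPotential n K rest.length := by simp [potential, h, hp, hK]
  rw [hpc]
  have e5 : ∑ j ∈ Finset.range rest.length, (walkPotential n K j + (rest.length + 1) - j) =
      2 * (n - 1) * ∑ j ∈ Finset.range rest.length, walkTime n K j +
        rest.length * (2 * n + 2 * (n - K) + rest.length + 2) := by
    have : ∀ j ∈ Finset.range rest.length, walkPotential n K j + (rest.length + 1) - j =
        2 * (n - 1) * walkTime n K j + (2 * n + 2 * (n - K) + rest.length + 2) := by
      intro j _
      rw [walkPotential]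
      ring
    rw [Finset.sum_congr rfl this, Finset.sum_add_distrib, Finset.sum_const, nsmul_eq_mul,
      Finset.card_range, Finset.mul_sum]
  rw [e5]
  simp only [choosePotential, walkPotential]
  -- Twice this product is the only slack: when the tree is hit, the `m + 1` path vertices release
  -- more credit than the attachment needs.
  have hkm : (0 : ℝ) ≤ K * rest.length := by positivity
  push_cast
  generalize ∑ j ∈ Finset.range rest.length, walkTime n K j = s at *
  generalize walkTime n (K + rest.length + 1) 0 = a at *
  generalize walkTime n K (rest.length + 1) = b at *
  generalize walkTime n K rest.length = d at *
  generalize (rest.length : ℝ) = m at *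
  have hs : s = (n - 1) * d - 1 - K * a - (n - K - (m + 1)) * b := by linarith
  rw [hs]
  nlinarith

theorem potential_step (hin : TreeInput vs es) (hI : Inv vs es c) :
    ({c | c.phase ≠ .done} : Set (Config n)).indicator 1 c +
      expect (step ⊤ c) (fun c => ENNReal.ofReal (potential vs.length c)) ≤
      ENNReal.ofReal (potential vs.length c) := by
  have hle : ∀ c : Config n, ({c | c.phase ≠ .done} : Set (Config n)).indicator 1 c ≤
      (1 : ℝ≥0∞) := Set.indicator_le_self' (by simp)
  cases h : c.phase with
  | init k =>
    refine (add_le_add_left (hle c) _).trans ?_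
    cases k with
    | zero =>
      refine one_add_expect_pure_le hin hI (step_init_zero h) ?_
      simp only [potential, h]
      push_cast
      linarith
    | succ k =>
      refine one_add_expect_pure_le hin hI (step_init_succ h) ?_
      simp only [potential, h]
      push_cast
      linarith
  | loadVertices =>
    refine (add_le_add_left (hle c) _).trans ?_
    cases hV : c.inV with
    | nil =>
      refine one_add_expect_pure_le hin hI (step_loadVertices_nil h hV) ?_
      simp only [potential, h, hV, List.length_nil]
      push_cast
      linarith
    | cons v l =>
      refine one_add_expect_pure_le hin hI (step_loadVertices_cons h hV) ?_
      simp only [potential, h, hV, addVertex_phase, addVertex_inE, List.length_cons]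
      push_cast
      linarith
  | loadEdges =>
    refine (add_le_add_left (hle c) _).trans ?_
    cases hE : c.inE with
    | nil =>
      refine one_add_expect_pure_le hin hI (step_loadEdges_nil h hE) ?_
      simp only [Inv, h] at hI
      simp only [potential, h, hE, hI.2.2, List.length_nil,
        List.toFinset_card_of_nodup hin.nodup]
      push_cast
      linarith
    | cons e l =>
      refine one_add_expect_pure_le hin hI (step_loadEdges_cons h hE) ?_
      simp only [potential, h, hE, List.length_cons]
      push_cast
      linarith
  | choose =>
    refine (add_le_add_left (hle c) _).trans ?_
    by_cases h0 : (c.free : ℕ) = 0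
    · refine one_add_expect_pure_le hin hI (step_choose_of_free_eq_zero h h0) ?_
      simp only [Inv, h] at hI
      have hlen := hI.2.length
      have hn := hin.length_pos.trans_le hin.length_le
      simp only [treeSet_eq_univ h0, Finset.card_univ, Fintype.card_fin] at hlen
      -- With `n - 1` edges, the `n` transpositions, the relabellings and the three changes of phase
      -- use up exactly `2 * n + 2`.
      have hlen' : (c.edges.length : ℝ) + 1 = n := by exact_mod_cast hlen
      simp only [potential, h, treeSet_eq_univ h0, Finset.card_univ, Fintype.card_fin,
        choosePotential, walkTime_self hn, Fin.val_last]
      linarith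
    · rw [step_choose h]
      refine one_add_expect_draw_ofReal_le (filter_free_nonempty h0) (fun i hi => ?_) ?_
      · exact potential_nonneg hin
          (inv_startWalk h hI (slot_notMem_treeSet (by simpa using hi)))
      · rw [Finset.sum_congr rfl fun i _ =>
          eq_sub_of_add_eq' (potential_startWalk (k := vs.length) h (c.slot i)), Finset.sum_const,
          nsmul_eq_mul]
        exact le_of_eq (by ring)
  | walk =>
    refine (add_le_add_left (hle c) _).trans ?_
    have hI' := hI
    simp only [Inv, h] at hI'
    obtain ⟨v, rest, hp⟩ := List.exists_cons_of_ne_nil hI'.1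
    rw [step_walk h hp]
    refine one_add_expect_draw_ofReal_le (moves_nonempty hin hI'.2 hp) (fun u hu => ?_) ?_
    · exact potential_nonneg hin (inv_moveTo h hp hI (Finset.ne_of_mem_erase hu))
    · rw [card_moves v]
      exact sum_potential_moveTo_le hin h hp hI'.2
  | erase u =>
    refine (add_le_add_left (hle c) _).trans ?_
    have hI' := hI
    simp only [Inv, h] at hI'
    obtain ⟨v, rest, hp⟩ := List.exists_cons_of_ne_nil (List.ne_nil_of_mem hI'.1)
    by_cases hvu : v = u
    · subst hvu
      refine one_add_expect_pure_le hin hI (step_erase_self h hp) ?_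
      simp only [potential, h, hp, dropWhile_ne_cons_self]
      linarith
    · refine one_add_expect_pure_le hin hI (step_erase_of_ne h hp hvu) ?_
      simp only [potential, h, hp, dropWhile_ne_cons_of_ne _ hvu, List.length_cons]
      push_cast
      linarith
  | attach =>
    refine (add_le_add_left (hle c) _).trans ?_
    have hI' := hI
    simp only [Inv, h] at hI'
    cases hp : c.path with
    | nil =>
      refine one_add_expect_pure_le hin hI (step_attach_nil h hp) ?_
      simp only [potential, h, hp, List.length_nil]
      simp
      linarith
    | cons v rest =>
      refine one_add_expect_pure_le hin hI (step_attach_cons h hp) ?_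
      have hv := hI'.outside v (by simp [hp])
      simp only [potential, h, hp, attachHead, addVertex_phase, treeSet_addVertex hv,
        Finset.card_insert_of_notMem hv, List.length_cons]
      rw [add_assoc (treeSet c.slot c.free).card, add_comm 1 rest.length]
      push_cast
      linarith
  | shuffle k =>
    refine (add_le_add_left (hle c) _).trans ?_
    obtain ⟨k, hk⟩ := k
    cases k with
    | zero =>
      refine one_add_expect_pure_le hin hI (step_shuffle_zero h) ?_
      simp only [potential, h]
      push_cast
      linarith
    | succ i =>
      have hi : i < n := by omega
      rw [step_shuffle_succ hi h]
      refine one_add_expect_draw_ofReal_le ⟨⟨i, hi⟩, by simp⟩ (fun j hj => ?_) ?_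
      · exact potential_nonneg hin (inv_shuffleTo h hi j hI)
      · have : ∀ j ∈ Finset.Iic (⟨i, hi⟩ : Fin n),
            potential vs.length (shuffleTo c i hi j) = potential vs.length c - 1 := by
          intro j _
          simp only [potential, shuffleTo, h]
          push_cast
          ring
        rw [Finset.sum_congr rfl this, Finset.sum_const, nsmul_eq_mul]
        exact le_of_eq (by ring)
  | relabel =>
    refine (add_le_add_left (hle c) _).trans ?_
    cases hE : c.edges with
    | nil =>
      refine one_add_expect_pure_le hin hI (step_relabel_nil h hE) ?_
      simp only [potential, h, hE, List.length_nil]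
      simp
    | cons e l =>
      refine one_add_expect_pure_le hin hI (step_relabel_cons h hE) ?_
      simp only [potential, h, hE, List.length_cons]
      push_cast
      linarith
  | done =>
    rw [step_done h, expect_pure]
    simp [h]

theorem expectedTime_le (hin : TreeInput vs es) : expectedTime vs es ≤ 15 * n := by
  have h1 : expectedTime vs es ≤ ENNReal.ofReal (potential vs.length (start vs es)) := by
    simp only [expectedTime, law_eq_chain, toOuterMeasure_eq_expect]
    exact sum_chain_le_of_potential inv_start (inv_step hin) fun c hI => potential_step hin hI
  refine h1.trans ?_
  -- The constant is generous: with `walkTime ≤ 2` the initial potential is at most `9 * n`.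
  have h2 : potential vs.length (start vs es) ≤ 15 * n := by
    have hk : (1 : ℝ) ≤ vs.length := by exact_mod_cast hin.length_pos
    have hkn : (vs.length : ℝ) ≤ n := by exact_mod_cast hin.length_le
    have he : (es.length : ℝ) + 1 = vs.length := by exact_mod_cast hin.length
    have hw : walkTime n vs.length 0 ≤ 2 := by
      have e1 : 1 / (vs.length : ℝ) ≤ 1 := by
        rw [div_le_one (by linarith)]
        exact hk
      have e2 : ((n : ℝ) - vs.length - 1) / n ≤ 1 := by
        rw [div_le_one (by linarith)]
        linarith
      simp only [walkTime, Finset.range_zero, Finset.sum_empty]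
      linarith
    have := mul_le_mul_of_nonneg_left hw (by linarith : (0 : ℝ) ≤ (n : ℝ) - 1)
    simp only [potential, start, choosePotential]
    nlinarith
  refine (ENNReal.ofReal_le_ofReal h2).trans (le_of_eq ?_)
  rw [ENNReal.ofReal_mul (by norm_num), ENNReal.ofReal_natCast]
  norm_num

end RunningTime

/-! ## A harmonic function for Wilson's algorithm on the complete graph -/

section Harmonic

open scoped Classical

/-- The probability that Wilson's algorithm on `n` vertices completes a tree with `k` vertices to a
given spanning tree that contains it. -/
def completionWeight (n k : ℕ) : ℝ := (n : ℝ) ^ (k + 1) / ((n : ℝ) ^ n * k)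

theorem completionWeight_nonneg (n k : ℕ) : 0 ≤ completionWeight n k := by
  unfold completionWeight; positivity

/-- This is the ratio of the counts `k * n ^ (n - k - 1)` and `(k + 1) * n ^ (n - k - 2)`, and the
only property of the weight used in the averaging identity. -/
theorem completionWeight_succ {n k : ℕ} (hn : 0 < n) (hk : 0 < k) :
    completionWeight n (k + 1) * (k + 1) = completionWeight n k * (n * k) := by
  have h1 : (n : ℝ) ≠ 0 := by positivity
  have h2 : (k : ℝ) ≠ 0 := by positivity
  have h3 : (k : ℝ) + 1 ≠ 0 := by positivity
  unfold completionWeight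
  push_cast
  field_simp
  ring

theorem completionWeight_self {n : ℕ} (hn : 0 < n) : completionWeight n n = 1 := by
  have h1 : (n : ℝ) ≠ 0 := by positivity
  unfold completionWeight
  field_simp
  ring

theorem completionWeight_le_one {n k : ℕ} (hk : 0 < k) (h : k ≤ n) : completionWeight n k ≤ 1 := by
  rcases h.lt_or_eq with h | rfl
  · have hn : (1 : ℝ) ≤ n := by exact_mod_cast (by omega : 1 ≤ n)
    have hk' : (1 : ℝ) ≤ k := by exact_mod_cast hk
    unfold completionWeight
    rw [div_le_one (by positivity)]
    calc (n : ℝ) ^ (k + 1) ≤ (n : ℝ) ^ n := pow_le_pow_right₀ hn h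
      _ ≤ (n : ℝ) ^ n * k := le_mul_of_one_le_right (by positivity) hk'
  · exact (completionWeight_self hk).le

variable {n : ℕ}

/-- The path, whose head is the position of the walker, follows the parent map `p`. -/
def Follows (p : Fin n → Fin n) : List (Fin n) → Prop := List.IsChain fun a b => p b = a

variable {p : Fin n → Fin n} {k : ℕ}

theorem follows_cons_cons {u v : Fin n} {l : List (Fin n)} :
    Follows p (u :: v :: l) ↔ p v = u ∧ Follows p (v :: l) := List.isChain_cons_cons

theorem follows_singleton (v : Fin n) : Follows p [v] := List.isChain_singleton v

/-- The probability of completing to the tree of `p` when the walker, having started along the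
path `l`, has left it for a vertex that does not follow `p`. -/
def detourWeight (p : Fin n → Fin n) (k : ℕ) : List (Fin n) → ℝ
  | [] => 0
  | v :: l => detourWeight p k l +
      if Follows p (v :: l) then completionWeight n (k + l.length) / (k + l.length + 1) else 0

/-- The probability of completing to the tree of `p` from a given path, if the tree has `k`
vertices. -/
def pathWeight (p : Fin n → Fin n) (k : ℕ) : List (Fin n) → ℝ
  | [] => 0
  | v :: l => detourWeight p k l +
      if Follows p (v :: l) then completionWeight n (k + l.length) else 0

theorem detourWeight_nonneg (l : List (Fin n)) : 0 ≤ detourWeight p k l := by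
  induction l with
  | nil => exact le_rfl
  | cons v l ih =>
    rw [detourWeight]
    have := completionWeight_nonneg n (k + l.length)
    split_ifs <;> positivity

theorem pathWeight_nonneg (l : List (Fin n)) : 0 ≤ pathWeight p k l := by
  cases l with
  | nil => exact le_rfl
  | cons v l =>
    rw [pathWeight]
    have := completionWeight_nonneg n (k + l.length)
    have := detourWeight_nonneg (p := p) (k := k) l
    split_ifs <;> positivity

theorem detourWeight_le (hk : 0 < k) {l : List (Fin n)} (h : k + l.length ≤ n) :
    detourWeight p k l ≤ l.length := by
  induction l with
  | nil => simp [detourWeight]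
  | cons v l ih =>
    rw [List.length_cons] at h
    have h1 := completionWeight_le_one (n := n) (k := k + l.length) (by omega) (by omega)
    have h2 : completionWeight n (k + l.length) / (k + l.length + 1) ≤ 1 := by
      rw [div_le_one (by positivity)]
      have : (0 : ℝ) ≤ (k : ℝ) + l.length := by positivity
      linarith
    rw [detourWeight, List.length_cons]
    push_cast
    split_ifs <;> linarith [ih (by omega)]

theorem pathWeight_le (hk : 0 < k) {l : List (Fin n)} (h : k + l.length ≤ n) :
    pathWeight p k l ≤ l.length := by
  cases l with
  | nil => simp [pathWeight]
  | cons v l =>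
    rw [List.length_cons] at h
    have h1 := completionWeight_le_one (n := n) (k := k + l.length) (by omega) (by omega)
    have h2 := detourWeight_le (p := p) hk (l := l) (by omega)
    rw [pathWeight, List.length_cons]
    push_cast
    split_ifs <;> linarith

/-- This is why `detourWeight` has the denominators `k + l.length + 1`: its last term times this
denominator is the weight that the longest suffix adds, so the induction closes. It evaluates the
total contribution of the moves that close a loop. -/
theorem sumSuffix_pathWeight (hk : 0 < k) (l : List (Fin n)) :
    sumSuffix (pathWeight p k) l = (k + l.length) * detourWeight p k l := by
  induction l with
  | nil => simp [sumSuffix, detourWeight]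
  | cons v l ih =>
    have : (k : ℝ) + l.length + 1 ≠ 0 := by positivity
    rw [sumSuffix, ih, pathWeight, detourWeight, List.length_cons]
    push_cast
    split_ifs
    · field_simp
      ring
    · ring

/-- The identity behind the harmonicity of `pathWeight`. -/
theorem pathWeight_average {v : Fin n} {l : List (Fin n)} (hn : 0 < n) (hk : 0 < k) :
    (k + l.length) * detourWeight p k l +
      (((n : ℝ) - k - (l.length + 1)) * detourWeight p k (v :: l) +
        if Follows p (v :: l) then completionWeight n (k + l.length + 1) else 0) =
      ((n : ℝ) - 1) * pathWeight p k (v :: l) := by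
  have h := completionWeight_succ (n := n) (k := k + l.length) hn (by omega)
  push_cast at h
  have h1 : (k : ℝ) + l.length + 1 ≠ 0 := by positivity
  rw [pathWeight, detourWeight]
  split_ifs
  · rw [← eq_div_iff h1] at h
    rw [h]
    field_simp
    ring
  · ring

/-- Along a path that follows `p`, each newer vertex is the parent of the preceding one, so the rank
decreases up to the head. -/
theorem rank_le_of_follows {r : Fin n} {d : Fin n → ℕ} (hd : ∀ v, v ≠ r → d (p v) < d v)
    {v : Fin n} {l : List (Fin n)} (hf : Follows p (v :: l)) (hr : r ∉ v :: l) :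
    ∀ x ∈ v :: l, d v ≤ d x := by
  induction l generalizing v with
  | nil => simp
  | cons w l ih =>
    obtain ⟨h1, h2⟩ := follows_cons_cons.1 hf
    intro x hx
    rcases List.mem_cons.1 hx with rfl | hx
    · exact le_rfl
    · have hw : w ≠ r := fun h => hr (by simp [h])
      have := hd w hw
      rw [h1] at this
      exact this.le.trans (ih h2 (fun h => hr (List.mem_cons_of_mem _ h)) x hx)

/-- The parent of the head has smaller rank than every vertex of the path, so the walker can always
continue along `p` without closing a loop. -/
theorem ParentMap.notMem_of_follows {T : SimpleGraph (Fin n)} {r : Fin n} (hp : ParentMap T r p)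
    {v : Fin n} {l : List (Fin n)} (hf : Follows p (v :: l)) (hr : r ∉ v :: l) :
    p v ∉ v :: l := by
  obtain ⟨d, hd⟩ := hp.rank
  intro h
  have h1 := rank_le_of_follows hd hf hr _ h
  have h2 := hd v fun h => hr (by simp [h])
  omega

/-- The probability that the tree grown from `vs` and `es` will be `T`, with parent map `p`. -/
def treeValue (vs : List (Fin n)) (es : List (Fin n × Fin n)) (T : SimpleGraph (Fin n))
    (p : Fin n → Fin n) (c : Config n) : ℝ :=
  match c.phase with
  | .choose => if ∀ e ∈ c.edges, T.Adj e.1 e.2 then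
      completionWeight n (treeSet c.slot c.free).card else 0
  | .walk => if ∀ e ∈ c.edges, T.Adj e.1 e.2 then
      pathWeight p (treeSet c.slot c.free).card c.path else 0
  | .erase u => if ∀ e ∈ c.edges, T.Adj e.1 e.2 then
      pathWeight p (treeSet c.slot c.free).card (c.path.dropWhile (· ≠ u)) else 0
  | .attach => if (∀ e ∈ c.edges, T.Adj e.1 e.2) ∧ Follows p c.path then
      completionWeight n ((treeSet c.slot c.free).card + c.path.length) else 0
  -- This value is meant for the phases that read the input, where nothing random happens. For the
  -- phases after the growth, `outputValue` has its own formulas.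
  | _ => if ∀ e ∈ es, T.Adj e.1 e.2 then completionWeight n vs.length else 0

variable {vs : List (Fin n)} {es : List (Fin n × Fin n)} {c : Config n} {T : SimpleGraph (Fin n)}
  {r : Fin n}

theorem treeValue_nonneg : 0 ≤ treeValue vs es T p c := by
  have h := completionWeight_nonneg n
  unfold treeValue
  split <;> split_ifs <;> first | exact h _ | exact pathWeight_nonneg _ | exact le_rfl

theorem treeValue_le (hin : TreeInput vs es) (hI : Inv vs es c) : treeValue vs es T p c ≤ n := by
  have hl := hin.length_pos
  have hl' := hin.length_le
  have hn : (1 : ℝ) ≤ n := by exact_mod_cast (by omega : 1 ≤ n)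
  have h0 := (completionWeight_le_one hl hl').trans hn
  have h0' : (0 : ℝ) ≤ n := by linarith
  unfold treeValue
  split
  · rename_i h
    simp only [Inv, h] at hI
    have h1 := card_newSet hI.2
    split_ifs
    · exact (completionWeight_le_one (hI.2.one_le_card hin) (by omega)).trans hn
    · exact h0'
  · rename_i h
    simp only [Inv, h] at hI
    have h1 := card_newSet hI.2
    split_ifs
    · refine (pathWeight_le (hI.2.one_le_card hin) (by omega)).trans ?_
      exact_mod_cast (by omega)
    · exact h0'
  · rename_i u h
    simp only [Inv, h] at hI
    have h1 := card_newSet hI.2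
    have h3 : (c.path.dropWhile (· ≠ u)).length ≤ c.path.length :=
      (List.dropWhile_sublist _).length_le
    split_ifs
    · refine (pathWeight_le (hI.2.one_le_card hin) (by omega)).trans ?_
      exact Nat.cast_le.2 (by omega)
    · exact h0'
  · rename_i h
    simp only [Inv, h] at hI
    have h1 := card_newSet hI
    have h2 := hI.one_le_card hin
    split_ifs
    · exact (completionWeight_le_one (by omega) (by omega)).trans hn
    · exact h0'
  · split_ifs
    · exact h0
    · exact h0'

theorem treeValue_loadEdges_nil (hin : TreeInput vs es) (h : c.phase = .loadEdges)
    (hE : c.inE = []) (hI : Inv vs es c) :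
    treeValue vs es T p { c with phase := .choose } = treeValue vs es T p c := by
  simp only [Inv, h] at hI
  obtain ⟨-, he, hs⟩ := hI
  rw [hE, List.append_nil] at he
  simp only [treeValue, h, hs, List.toFinset_card_of_nodup hin.nodup, ← he, List.mem_reverse]

/-- A path of one vertex has the same weight as no path, whichever vertex it is: the choice of the
starting point has no influence on the law of the tree. -/
theorem treeValue_startWalk (h : c.phase = .choose) (v : Fin n) :
    treeValue vs es T p (startWalk c v) = treeValue vs es T p c := by
  simp [treeValue, startWalk, h, pathWeight, detourWeight, follows_singleton]

/-- Moves that close a loop contribute the suffix sum, every move to a new vertex contributes the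
detour weight, and the single move to `p v` contributes the extra weight if the path follows `p`.
The total is the left side of `pathWeight_average`. -/
theorem sum_treeValue_moveTo (hin : TreeInput vs es) (hr : r ∈ vs) (hT : ParentMap T r p)
    (h : c.phase = .walk) {v : Fin n} {rest : List (Fin n)} (hp : c.path = v :: rest)
    (hg : Growing vs es c (treeSet c.slot c.free)) :
    ∑ u ∈ Finset.univ.erase v, treeValue vs es T p (moveTo c v u) =
      ((n : ℝ) - 1) * treeValue vs es T p c := by
  by_cases hgood : ∀ e ∈ c.edges, T.Adj e.1 e.2
  swap
  · have : treeValue vs es T p c = 0 := by simp only [treeValue, h, if_neg hgood]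
    rw [this, mul_zero]
    refine Finset.sum_eq_zero fun u _ => ?_
    unfold moveTo
    split_ifs
    · simp only [treeValue]
      exact if_neg fun h1 => hgood fun e he => h1.1 e (List.mem_cons_of_mem _ he)
    · simp only [treeValue, if_neg hgood]
    · simp only [treeValue, h, if_neg hgood]
  have hcl := hg.closed T r p hr hT hgood
  have hcard := card_newSet hg
  have hk := hg.one_le_card hin
  have hn := hg.nodup
  have ho := hg.outside
  rw [hp] at hn ho
  rw [hp, List.length_cons] at hcard
  have hcard' : ((newSet c).card : ℝ) =
      n - (treeSet c.slot c.free).card - (rest.length + 1) := by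
    rw [eq_sub_iff_add_eq, eq_sub_iff_add_eq]
    exact_mod_cast (by omega)
  have hvK := ho v List.mem_cons_self
  have hrK := hg.mem r hr
  have hvr : v ≠ r := fun h => hvK (h ▸ hrK)
  set K := treeSet c.slot c.free with hK
  set W := completionWeight n (K.card + rest.length + 1) with hW
  have e1 : ∑ u ∈ K, treeValue vs es T p (moveTo c v u) =
      if Follows p (v :: rest) ∧ p v ∈ K then W else 0 := by
    have : ∀ u ∈ K, treeValue vs es T p (moveTo c v u) =
        if p v = u then if Follows p (v :: rest) then W else 0 else 0 := by
      intro u hu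
      -- The target can contain the edge from `v` to the tree vertex `u` only with `u` as the
      -- parent, by closure of the tree under parents.
      have hadj : T.Adj v u ↔ p v = u := by
        rw [hT.adj_iff]
        refine ⟨fun h => ?_, fun h => Or.inl ⟨hvr, h⟩⟩
        rcases h with h | h
        · exact h.2
        · exact absurd (h.2 ▸ hcl u hu) hvK
      rw [moveTo_of_mem_treeSet hu]
      simp only [treeValue, hp, List.forall_mem_cons, hadj, List.length_cons, ← hK, ← add_assoc,
        ← hW, and_iff_left hgood]
      by_cases h1 : p v = u <;> by_cases h2 : Follows p (v :: rest) <;> simp [h1, h2]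
    rw [Finset.sum_congr rfl this, Finset.sum_ite_eq]
    by_cases h1 : p v ∈ K <;> by_cases h2 : Follows p (v :: rest) <;> simp [h1, h2]
  have e2 : ∑ u ∈ rest.toFinset, treeValue vs es T p (moveTo c v u) =
      (K.card + rest.length) * detourWeight p K.card rest := by
    rw [← sumSuffix_pathWeight hk, ← sum_dropWhile_eq_sumSuffix _ (List.nodup_cons.1 hn).2]
    refine Finset.sum_congr rfl fun u hu => ?_
    have hu' : u ∈ rest := by simpa using hu
    rw [moveTo_of_mem_rest hg hp hu']
    simp only [treeValue, dropWhile_path_of_mem_rest hg hp hu', ← hK]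
    exact if_pos hgood
  have e3 : ∑ u ∈ newSet c, treeValue vs es T p (moveTo c v u) =
      ((n : ℝ) - K.card - (rest.length + 1)) * detourWeight p K.card (v :: rest) +
        if Follows p (v :: rest) ∧ p v ∈ newSet c then W else 0 := by
    have : ∀ u ∈ newSet c, treeValue vs es T p (moveTo c v u) =
        detourWeight p K.card (v :: rest) +
          if p v = u then if Follows p (v :: rest) then W else 0 else 0 := by
      intro u hu
      rw [moveTo_of_mem_newSet hg hu]
      simp only [treeValue, h, hp, pathWeight, follows_cons_cons, List.length_cons, ← hK,
        ← add_assoc, ← hW, if_pos hgood]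
      by_cases h1 : p v = u <;> by_cases h2 : Follows p (v :: rest) <;> simp [h1, h2]
    rw [Finset.sum_congr rfl this, Finset.sum_add_distrib, Finset.sum_const, nsmul_eq_mul, hcard',
      Finset.sum_ite_eq]
    by_cases h1 : p v ∈ newSet c <;> by_cases h2 : Follows p (v :: rest) <;> simp [h1, h2]
  -- If the path follows `p`, then `p v` is not on it, so it is in exactly one of the tree and the
  -- set of new vertices.
  have e4 : ((if Follows p (v :: rest) ∧ p v ∈ K then W else 0) +
      if Follows p (v :: rest) ∧ p v ∈ newSet c then W else 0) =
      if Follows p (v :: rest) then W else 0 := by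
    by_cases h2 : Follows p (v :: rest)
    · have h3 := hT.notMem_of_follows h2 fun h => ho r h hrK
      by_cases h1 : p v ∈ K
      · have h4 : p v ∉ newSet c := by simp [newSet, ← hK, h1]
        simp [h2, h1, h4]
      · have h4 : p v ∈ newSet c := by simpa [newSet, ← hK, h1, hp] using h3
        simp [h2, h1, h4]
    · simp [h2]
  have e5 : treeValue vs es T p c = pathWeight p K.card (v :: rest) := by
    simp only [treeValue, h, if_pos hgood, hp, ← hK]
  rw [sum_moves hg hp, ← hK, e1, e2, e3, e5,
    ← pathWeight_average (by omega) (by omega : 0 < K.card), ← hW, ← e4]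
  ring

theorem treeValue_erase_self {u : Fin n} (h : c.phase = .erase u) {rest : List (Fin n)}
    (hp : c.path = u :: rest) :
    treeValue vs es T p { c with phase := .walk } = treeValue vs es T p c := by
  simp only [treeValue, h, hp, dropWhile_ne_cons_self]

theorem treeValue_erase_of_ne {u v : Fin n} (h : c.phase = .erase u) {rest : List (Fin n)}
    (hp : c.path = v :: rest) (hvu : v ≠ u) :
    treeValue vs es T p { c with path := rest, mark := Function.update c.mark v false } =
      treeValue vs es T p c := by
  simp only [treeValue, h, hp, dropWhile_ne_cons_of_ne _ hvu]

theorem treeValue_attach_nil (h : c.phase = .attach) (hp : c.path = []) :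
    treeValue vs es T p { c with phase := .choose } = treeValue vs es T p c := by
  simp [treeValue, h, hp, Follows]

/-- Attaching a vertex moves one condition from `Follows` to the recorded edges: the target contains
the edge of `w` and `v` exactly if `p w = v`, as `p v = w` would put `w` into the tree by closure at
`v`. The vertex count was already the final one. -/
theorem treeValue_attachHead (hr : r ∈ vs) (hT : ParentMap T r p) (h : c.phase = .attach)
    {v : Fin n} {rest : List (Fin n)} (hp : c.path = v :: rest) (hI : Inv vs es c) :
    treeValue vs es T p (attachHead c v rest) = treeValue vs es T p c := by
  simp only [Inv, h, hp, headSet] at hI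
  have hv := hI.outside v (by simp [hp])
  have hiff : ((∀ e ∈ (attachHead c v rest).edges, T.Adj e.1 e.2) ∧ Follows p rest) ↔
      (∀ e ∈ c.edges, T.Adj e.1 e.2) ∧ Follows p (v :: rest) := by
    cases rest with
    | nil => simp [attachHead, Follows]
    | cons w rest =>
      have hw := hI.outside w (by simp [hp])
      have hwr : w ≠ r := fun h => hw (h ▸ hI.mem r hr)
      simp only [attachHead, List.head?_cons, Option.map_some, Option.toList_some,
        List.singleton_append, List.forall_mem_cons, follows_cons_cons, hT.adj_iff w v]
      constructor
      · rintro ⟨⟨h1 | h1, h2⟩, h3⟩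
        · exact ⟨h2, h1.2, h3⟩
        · exact absurd (h1.2 ▸ hI.closed T r p hr hT h2 v (Finset.mem_insert_self _ _)) hw
      · rintro ⟨h2, h1, h3⟩
        exact ⟨⟨Or.inl ⟨hwr, h1⟩, h2⟩, h3⟩
  have hph : (attachHead c v rest).phase = .attach := by simp [attachHead, h]
  have hpa : (attachHead c v rest).path = rest := rfl
  have hK : treeSet (attachHead c v rest).slot (attachHead c v rest).free =
      insert v (treeSet c.slot c.free) := treeSet_addVertex hv
  simp only [treeValue, hph, hpa, h, hp, hK, Finset.card_insert_of_notMem hv, List.length_cons]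
  rw [add_assoc (treeSet c.slot c.free).card, add_comm 1 rest.length]
  by_cases h1 : (∀ e ∈ c.edges, T.Adj e.1 e.2) ∧ Follows p (v :: rest)
  · rw [if_pos h1, if_pos (hiff.2 h1)]
  · rw [if_neg h1, if_neg fun h2 => h1 (hiff.1 h2)]

end Harmonic

/-! ## The probability of an output -/

section Output

open scoped Classical

variable {n : ℕ}

/-- The permutations that move only the first `i` labels. -/
def fixing (n i : ℕ) : Finset (Equiv.Perm (Fin n)) :=
  Finset.univ.filter fun π => ∀ x : Fin n, i ≤ x → π x = x

theorem mem_fixing {i : ℕ} {π : Equiv.Perm (Fin n)} :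
    π ∈ fixing n i ↔ ∀ x : Fin n, i ≤ x → π x = x := by
  simp [fixing]

/-- The recursion behind the Fisher--Yates shuffle. -/
theorem sum_fixing_succ {i : ℕ} (hi : i < n) (F : Equiv.Perm (Fin n) → ℝ) :
    ∑ π ∈ fixing n (i + 1), F π =
      ∑ j ∈ Finset.Iic (⟨i, hi⟩ : Fin n), ∑ π ∈ fixing n i, F (Equiv.swap ⟨i, hi⟩ j * π) := by
  have hmaps : ∀ π ∈ fixing n (i + 1), π ⟨i, hi⟩ ∈ Finset.Iic (⟨i, hi⟩ : Fin n) := by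
    intro π hπ
    rw [mem_fixing] at hπ
    by_contra h
    rw [Finset.mem_Iic, not_le, Fin.lt_def] at h
    have h2 := π.injective (hπ _ h)
    rw [h2] at h
    exact lt_irrefl _ h
  rw [← Finset.sum_fiberwise_of_maps_to hmaps]
  refine Finset.sum_congr rfl fun j hj => ?_
  rw [Finset.mem_Iic, Fin.le_def] at hj
  refine Finset.sum_bij' (fun π _ => Equiv.swap ⟨i, hi⟩ j * π)
    (fun π _ => Equiv.swap ⟨i, hi⟩ j * π) ?_ ?_ ?_ ?_ ?_
  · intro π hπ
    obtain ⟨h1, h2⟩ := Finset.mem_filter.1 hπ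
    rw [mem_fixing] at h1 ⊢
    intro x hx
    rcases hx.lt_or_eq with hx | hx
    · rw [Equiv.Perm.mul_apply, h1 x hx]
      refine Equiv.swap_apply_of_ne_of_ne ?_ ?_
      · rintro rfl
        exact lt_irrefl _ hx
      · rintro rfl
        exact absurd hj (not_le.2 hx)
    · have : x = ⟨i, hi⟩ := Fin.ext hx.symm
      rw [this, Equiv.Perm.mul_apply, h2, Equiv.swap_apply_right]
  · intro π hπ
    rw [mem_fixing] at hπ
    refine Finset.mem_filter.2 ⟨?_, ?_⟩
    · rw [mem_fixing]
      intro x hx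
      rw [Equiv.Perm.mul_apply, hπ x (by omega)]
      refine Equiv.swap_apply_of_ne_of_ne ?_ ?_
      · rintro rfl
        simp at hx
      · rintro rfl
        exact absurd hj (by simpa using hx)
    · rw [Equiv.Perm.mul_apply, hπ _ le_rfl, Equiv.swap_apply_left]
  · intro π _
    rw [← mul_assoc, Equiv.swap_mul_self, one_mul]
  · intro π _
    rw [← mul_assoc, Equiv.swap_mul_self, one_mul]
  · intro π _
    rw [← mul_assoc, Equiv.swap_mul_self, one_mul]

theorem fixing_self : fixing n n = Finset.univ := by
  ext π
  simp only [mem_fixing, Finset.mem_univ, iff_true]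
  intro x hx
  exact absurd x.isLt (not_lt.2 hx)

theorem fixing_zero : fixing n 0 = {1} := by
  ext π
  simp [mem_fixing, Equiv.ext_iff]

/-- A parent map of `T` towards `r`, if there is one. -/
def parentOf (T : SimpleGraph (Fin n)) (r : Fin n) : Fin n → Fin n :=
  if h : ∃ p, ParentMap T r p then h.choose else id

theorem parentMap_parentOf {T : SimpleGraph (Fin n)} (hT : T.IsTree) (r : Fin n) :
    ParentMap T r (parentOf T r) := by
  rw [parentOf, dif_pos (exists_parentMap hT r)]
  exact (exists_parentMap hT r).choose_spec

theorem isTree_comap {T : SimpleGraph (Fin n)} (hT : T.IsTree) (π : Equiv.Perm (Fin n)) :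
    (T.comap π).IsTree :=
  (SimpleGraph.Iso.comap π T).isTree_iff.2 hT

/-- The probability of the output `T` while the tree is still growing. -/
def growingValue (vs : List (Fin n)) (es : List (Fin n × Fin n)) (r : Fin n)
    (T : SimpleGraph (Fin n)) (c : Config n) : ℝ :=
  (∑ π : Equiv.Perm (Fin n), treeValue vs es (T.comap π) (parentOf (T.comap π) r) c) /
    n.factorial

/-- The probability of the output `T`. -/
def outputValue (vs : List (Fin n)) (es : List (Fin n × Fin n)) (r : Fin n)
    (T : SimpleGraph (Fin n)) (c : Config n) : ℝ :=
  match c.phase with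
  | .shuffle i => (∑ π ∈ fixing n i,
      if edgeGraph (c.edges.map (Prod.map (c.label * π) (c.label * π))) = T then 1 else 0) /
        (i : ℕ).factorial
  | .relabel => if edgeGraph (c.edges.map (Prod.map c.label c.label) ++ c.out) = T then 1 else 0
  | .done => if edgeGraph c.out = T then 1 else 0
  | _ => growingValue vs es r T c

variable {vs : List (Fin n)} {es : List (Fin n × Fin n)} {c : Config n} {T : SimpleGraph (Fin n)}
  {r : Fin n}

theorem growingValue_nonneg : 0 ≤ growingValue vs es r T c :=
  div_nonneg (Finset.sum_nonneg fun _ _ => treeValue_nonneg) (by positivity)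

theorem growingValue_le (hin : TreeInput vs es) (hI : Inv vs es c) :
    growingValue vs es r T c ≤ n := by
  have hf : (0 : ℝ) < n.factorial := by positivity
  rw [growingValue, div_le_iff₀ hf]
  refine (Finset.sum_le_card_nsmul _ _ (n : ℝ) fun π _ => treeValue_le hin hI).trans ?_
  rw [Finset.card_univ, Fintype.card_perm, Fintype.card_fin, nsmul_eq_mul, mul_comm]

theorem outputValue_nonneg : 0 ≤ outputValue vs es r T c := by
  unfold outputValue
  split
  · exact div_nonneg (Finset.sum_nonneg fun _ _ => by split_ifs <;> norm_num) (by positivity)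
  · split_ifs <;> norm_num
  · split_ifs <;> norm_num
  · exact growingValue_nonneg

/-- The bound is crude. Only its finiteness and independence of the configuration matter for
`iSup_chain_eq_of_harmonic`. -/
theorem outputValue_le (hin : TreeInput vs es) (hI : Inv vs es c) :
    outputValue vs es r T c ≤ n + n.factorial := by
  have hf : (1 : ℝ) ≤ n.factorial := by exact_mod_cast n.factorial_pos
  have hn : (0 : ℝ) ≤ n := Nat.cast_nonneg n
  unfold outputValue
  split
  · rename_i i _
    have hi : (1 : ℝ) ≤ (i : ℕ).factorial := by exact_mod_cast (i : ℕ).factorial_pos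
    have hs : ∑ π ∈ fixing n i, (if edgeGraph (c.edges.map
        (Prod.map (c.label * π) (c.label * π))) = T then (1 : ℝ) else 0) ≤ n.factorial := by
      refine (Finset.sum_le_card_nsmul _ _ 1 fun π _ => by split_ifs <;> norm_num).trans ?_
      rw [nsmul_eq_mul, mul_one]
      refine Nat.cast_le.2 ((Finset.card_le_univ _).trans ?_)
      rw [Fintype.card_perm, Fintype.card_fin]
    refine (div_le_self (Finset.sum_nonneg fun _ _ => by split_ifs <;> norm_num) hi).trans ?_
    linarith
  · split_ifs <;> linarith
  · split_ifs <;> linarith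
  · linarith [growingValue_le (r := r) (T := T) hin hI]

theorem growingValue_congr {c' : Config n} (hT : T.IsTree)
    (h : ∀ T' p, ParentMap T' r p → treeValue vs es T' p c' = treeValue vs es T' p c) :
    growingValue vs es r T c' = growingValue vs es r T c := by
  unfold growingValue
  congr 1
  exact Finset.sum_congr rfl fun π _ => h _ _ (parentMap_parentOf (isTree_comap hT π) r)

theorem sum_growingValue {α : Type} {s : Finset α} {f : α → Config n} {x : ℝ} (hT : T.IsTree)
    (h : ∀ T' p, ParentMap T' r p →
      ∑ a ∈ s, treeValue vs es T' p (f a) = x * treeValue vs es T' p c) :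
    ∑ a ∈ s, growingValue vs es r T (f a) = x * growingValue vs es r T c := by
  unfold growingValue
  rw [← Finset.sum_div, Finset.sum_comm, mul_div_assoc', Finset.mul_sum]
  congr 1
  exact Finset.sum_congr rfl fun π _ => h _ _ (parentMap_parentOf (isTree_comap hT π) r)

theorem edgeGraph_map_eq_iff (π : Equiv.Perm (Fin n)) (E : List (Fin n × Fin n)) :
    edgeGraph (E.map (Prod.map π π)) = T ↔ edgeGraph E = T.comap π := by
  rw [edgeGraph_map_eq_comap]
  constructor
  · rintro rfl
    ext a b
    simp
  · intro h
    rw [h]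
    ext a b
    simp

/-- Once all vertices are in the tree the weight is one, and a spanning tree contained in the tree
`T.comap π` equals it. So containment of edges becomes the event that relabelling by `π` gives `T`.
-/
theorem outputValue_shuffle_last (hin : TreeInput vs es) (hT : T.IsTree) (h : c.phase = .choose)
    (h0 : (c.free : ℕ) = 0) (hI : Inv vs es c) :
    outputValue vs es r T { c with phase := .shuffle (Fin.last n) } =
      outputValue vs es r T c := by
  have htree := inv_shuffle_last hin h h0 hI
  simp only [Inv] at htree
  simp only [Inv, h] at hI
  have hn := hin.length_pos.trans_le hin.length_le
  simp only [outputValue, h, growingValue, Fin.val_last, fixing_self, treeValue,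
    treeSet_eq_univ h0, Finset.card_univ, Fintype.card_fin, completionWeight_self hn]
  congr 1
  refine Finset.sum_congr rfl fun π _ => ?_
  refine if_congr ?_ rfl rfl
  rw [hI.2.label, one_mul, edgeGraph_map_eq_iff, ← edgeGraph_le_iff hI.2.ne]
  exact ⟨fun h => h.le, eq_of_le_of_isTree htree.2.2 (isTree_comap hT π)⟩

/-- `sum_fixing_succ` splits the remaining permutations by the next transposition, and the `i + 1`
choices account for the quotient of `(i + 1)!` and `i!`. -/
theorem sum_outputValue_shuffleTo {i : ℕ} (hi : i < n) (h : c.phase = .shuffle ⟨i + 1, by omega⟩) :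
    ∑ j ∈ Finset.Iic (⟨i, hi⟩ : Fin n), outputValue vs es r T (shuffleTo c i hi j) =
      (Finset.Iic (⟨i, hi⟩ : Fin n)).card * outputValue vs es r T c := by
  simp only [outputValue, shuffleTo, h, Fin.card_Iic, sum_fixing_succ hi, mul_assoc,
    ← Finset.sum_div, Nat.factorial_succ]
  have h1 : ((i : ℝ) + 1) ≠ 0 := by positivity
  have h2 : (i.factorial : ℝ) ≠ 0 := by positivity
  push_cast
  field_simp

theorem outputValue_shuffle_zero (h : c.phase = .shuffle 0) (hI : Inv vs es c) :
    outputValue vs es r T { c with phase := .relabel } = outputValue vs es r T c := by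
  simp only [Inv, h] at hI
  simp [outputValue, h, fixing_zero, hI.1]

theorem outputValue_harmonic (hin : TreeInput vs es) (hr : r ∈ vs) (hT : T.IsTree)
    (hI : Inv vs es c) :
    expect (step ⊤ c) (fun c => ENNReal.ofReal (outputValue vs es r T c)) =
      ENNReal.ofReal (outputValue vs es r T c) := by
  have hpure : ∀ {b : Config n}, step ⊤ c = PMF.pure b →
      outputValue vs es r T b = outputValue vs es r T c →
      expect (step ⊤ c) (fun c => ENNReal.ofReal (outputValue vs es r T c)) =
        ENNReal.ofReal (outputValue vs es r T c) := by
    intro b hs hb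
    rw [hs, expect_pure, hb]
  cases h : c.phase with
  | init k =>
    cases k with
    | zero =>
      refine hpure (step_init_zero h) ?_
      simp only [outputValue, h]
      exact growingValue_congr hT fun T' p _ => by simp only [treeValue, h]
    | succ k =>
      refine hpure (step_init_succ h) ?_
      simp only [outputValue, h]
      exact growingValue_congr hT fun T' p _ => by simp only [treeValue, h]
  | loadVertices =>
    cases hV : c.inV with
    | nil =>
      refine hpure (step_loadVertices_nil h hV) ?_
      simp only [outputValue, h]
      exact growingValue_congr hT fun T' p _ => by simp only [treeValue, h]
    | cons v l =>
      refine hpure (step_loadVertices_cons h hV) ?_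
      simp only [outputValue, h, addVertex_phase]
      exact growingValue_congr hT fun T' p _ => by simp only [treeValue, h]
  | loadEdges =>
    cases hE : c.inE with
    | nil =>
      refine hpure (step_loadEdges_nil h hE) ?_
      simp only [outputValue, h]
      exact growingValue_congr hT fun T' p _ => treeValue_loadEdges_nil hin h hE hI
    | cons e l =>
      refine hpure (step_loadEdges_cons h hE) ?_
      simp only [outputValue, h]
      exact growingValue_congr hT fun T' p _ => by simp only [treeValue, h]
  | choose =>
    by_cases h0 : (c.free : ℕ) = 0
    · exact hpure (step_choose_of_free_eq_zero h h0) (outputValue_shuffle_last hin hT h h0 hI)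
    · rw [step_choose h]
      refine expect_draw_ofReal_eq (filter_free_nonempty h0) (fun _ _ => outputValue_nonneg) ?_
      rw [← nsmul_eq_mul, ← Finset.sum_const]
      refine Finset.sum_congr rfl fun i _ => ?_
      have hph : (startWalk c (c.slot i)).phase = .walk := rfl
      simp only [outputValue, h, hph]
      exact growingValue_congr hT fun T' p _ => treeValue_startWalk h _
  | walk =>
    have hI' := hI
    simp only [Inv, h] at hI'
    obtain ⟨v, rest, hp⟩ := List.exists_cons_of_ne_nil hI'.1
    rw [step_walk h hp]
    refine expect_draw_ofReal_eq (moves_nonempty hin hI'.2 hp) (fun _ _ => outputValue_nonneg) ?_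
    have h1 : ∀ u, outputValue vs es r T (moveTo c v u) =
        growingValue vs es r T (moveTo c v u) := by
      intro u
      unfold moveTo
      split_ifs <;> simp only [outputValue, h]
    have h2 : outputValue vs es r T c = growingValue vs es r T c := by simp only [outputValue, h]
    simp only [h1, h2, card_moves v]
    exact sum_growingValue hT fun T' p hp' => sum_treeValue_moveTo hin hr hp' h hp hI'.2
  | erase u =>
    have hI' := hI
    simp only [Inv, h] at hI'
    obtain ⟨v, rest, hp⟩ := List.exists_cons_of_ne_nil (List.ne_nil_of_mem hI'.1)
    by_cases hvu : v = u
    · subst hvu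
      refine hpure (step_erase_self h hp) ?_
      simp only [outputValue, h]
      exact growingValue_congr hT fun T' p _ => treeValue_erase_self h hp
    · refine hpure (step_erase_of_ne h hp hvu) ?_
      simp only [outputValue, h]
      refine growingValue_congr hT fun T' p _ => ?_
      rw [← treeValue_erase_of_ne h hp hvu, h]
  | attach =>
    cases hp : c.path with
    | nil =>
      refine hpure (step_attach_nil h hp) ?_
      simp only [outputValue, h]
      exact growingValue_congr hT fun T' p _ => treeValue_attach_nil h hp
    | cons v rest =>
      refine hpure (step_attach_cons h hp) ?_
      have hph : (attachHead c v rest).phase = .attach := by simp [attachHead, h]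
      simp only [outputValue, h, hph]
      exact growingValue_congr hT fun T' p hp' => treeValue_attachHead hr hp' h hp hI
  | shuffle k =>
    obtain ⟨k, hk⟩ := k
    cases k with
    | zero => exact hpure (step_shuffle_zero h) (outputValue_shuffle_zero h hI)
    | succ i =>
      have hi : i < n := by omega
      rw [step_shuffle_succ hi h]
      exact expect_draw_ofReal_eq ⟨⟨i, hi⟩, by simp⟩ (fun _ _ => outputValue_nonneg)
        (sum_outputValue_shuffleTo hi h)
  | relabel =>
    cases hE : c.edges with
    | nil =>
      refine hpure (step_relabel_nil h hE) ?_
      simp only [outputValue, h, hE, List.map_nil, List.nil_append]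
    | cons e l =>
      refine hpure (step_relabel_cons h hE) ?_
      simp only [outputValue, h, hE]
      rw [edgeGraph_relabel_cons]
  | done => exact hpure (step_done h) rfl

theorem expectedTime_ne_top (hin : TreeInput vs es) : expectedTime vs es ≠ ∞ :=
  ne_top_of_le_ne_top (ENNReal.mul_ne_top (by norm_num) (by simp)) (expectedTime_le hin)

theorem tsum_not_done_ne_top (hin : TreeInput vs es) :
    ∑' t, (chain (step ⊤) (start vs es) t).toOuterMeasure
      ({c : Config n | c.phase = .done} : Set (Config n))ᶜ ≠ ∞ := by
  have h := expectedTime_ne_top hin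
  simp only [expectedTime, law_eq_chain] at h
  exact h

theorem outputProb_eq_outputValue (hin : TreeInput vs es) (hr : r ∈ vs) (hT : T.IsTree) :
    outputProb vs es T = ENNReal.ofReal (outputValue vs es r T (start vs es)) := by
  simp only [outputProb, law_eq_chain]
  refine iSup_chain_eq_of_harmonic (D := {c : Config n | c.phase = .done})
    (B := ENNReal.ofReal (n + n.factorial)) inv_start (inv_step hin)
    (h := fun c => ENNReal.ofReal (outputValue vs es r T c))
    (fun c hI => outputValue_harmonic hin hr hT hI) (fun c hc => hc.1) ?_ ENNReal.ofReal_ne_top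
    (fun c hI => ENNReal.ofReal_le_ofReal (outputValue_le hin hI)) (tsum_not_done_ne_top hin)
  intro c _ hc
  have hc' : c.phase = .done := hc
  have hres : c.result = edgeGraph c.out := rfl
  simp only [outputValue, hc', Set.indicator_apply, Set.mem_ofPred_eq, true_and, hres,
    Pi.one_apply]
  split_ifs <;> simp

/-- At the start the harmonic function is an average over `π` of a constant weight times the
indicator that `T.comap π` contains the seed. Only the number of such `π` depends on `T`. -/
theorem outputProb_eq (hin : TreeInput vs es) (hT : T.IsTree) :
    outputProb vs es T = ENNReal.ofReal (completionWeight n vs.length / n.factorial) *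
      (Nat.card {π : Equiv.Perm (Fin n) // ∀ e ∈ es, T.Adj (π e.1) (π e.2)} : ℝ≥0∞) := by
  rw [outputProb_eq_outputValue hin (List.head_mem hin.ne_nil) hT, ← ENNReal.ofReal_natCast,
    ← ENNReal.ofReal_mul (div_nonneg (completionWeight_nonneg _ _) (by positivity))]
  congr 1
  simp only [outputValue, start, growingValue, treeValue, SimpleGraph.comap_adj]
  rw [← Finset.sum_filter, Finset.sum_const, nsmul_eq_mul, Nat.card_eq_fintype_card,
    Fintype.card_subtype]
  ring

theorem outputProb_of_not_isTree (hin : TreeInput vs es) (hT : ¬ T.IsTree) :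
    outputProb vs es T = 0 := by
  simp only [outputProb, law_eq_chain, ENNReal.iSup_eq_zero]
  intro t
  rw [PMF.toOuterMeasure_apply_eq_zero_iff, Set.disjoint_left]
  rintro c hc ⟨h1, h2⟩
  have hI := chain_invariant inv_start (inv_step hin) t c hc
  simp only [Inv, h1] at hI
  exact hT (h2 ▸ hI.2)

/-- The constant function one is harmonic, and the expected time is finite, so the procedure halts
almost surely. Each halted configuration has exactly one output graph. -/
theorem tsum_outputProb (hin : TreeInput vs es) :
    ∑' T : SimpleGraph (Fin n), outputProb vs es T = 1 := by
  have h1 : ⨆ t, (chain (step ⊤) (start vs es) t).toOuterMeasure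
      ({c : Config n | c.phase = .done} : Set (Config n)) = 1 := by
    refine iSup_chain_eq_of_harmonic (D := {c : Config n | c.phase = .done}) (B := 1)
      inv_start (inv_step hin) (h := fun _ => 1) (fun c _ => expect_one _) subset_rfl ?_
      ENNReal.one_ne_top (fun _ _ => le_rfl) (tsum_not_done_ne_top hin)
    intro c _ hc
    rw [Set.indicator_of_mem hc]
    rfl
  have hfin : Fintype (SimpleGraph (Fin n)) := Fintype.ofFinite _
  rw [tsum_fintype, ← h1]
  simp only [outputProb, law_eq_chain]
  rw [ENNReal.finsetSum_iSup_of_monotone]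
  · congr 1
    funext t
    simp only [toOuterMeasure_eq_expect]
    rw [← expect_sum]
    refine expect_congr fun c _ => ?_
    by_cases hc : c.phase = .done <;> simp [Set.indicator_apply, hc]
  · intro T
    exact chain_monotone_of_absorbing fun c hc => step_done hc.1

end Output

/-! ## Counting the copies of a tree -/

section Copies

variable {V : Type} {G T : SimpleGraph V}

/-- The permutation `π` maps the subgraph `τ` onto `S`. -/
def MapsOnto (τ : G.Subgraph) (S : T.Subgraph) (π : Equiv.Perm V) : Prop :=
  (∀ a, π a ∈ S.verts ↔ a ∈ τ.verts) ∧ ∀ a b, S.Adj (π a) (π b) ↔ τ.Adj a b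

/-- In a finite set a bijection between two subsets extends to a permutation. Adjacency in a
subgraph involves only its own vertices, so the extension cannot create or destroy any. -/
theorem exists_mapsOnto [Finite V] {τ : G.Subgraph} {S : T.Subgraph} (φ : S.coe ≃g τ.coe) :
    ∃ π, MapsOnto τ S π := by
  classical
  have := Fintype.ofFinite V
  let e : {x // x ∈ τ.verts} ≃ {x // x ∈ S.verts} := φ.symm.toEquiv
  have hmem : ∀ a, e.extendSubtype a ∈ S.verts ↔ a ∈ τ.verts := by
    intro a
    by_cases ha : a ∈ τ.verts
    · exact iff_of_true (e.extendSubtype_mem a ha) ha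
    · exact iff_of_false (e.extendSubtype_not_mem a ha) ha
  refine ⟨e.extendSubtype, hmem, fun a b => ?_⟩
  by_cases ha : a ∈ τ.verts
  · by_cases hb : b ∈ τ.verts
    · rw [e.extendSubtype_apply_of_mem a ha, e.extendSubtype_apply_of_mem b hb]
      exact φ.symm.map_adj_iff (v := ⟨a, ha⟩) (w := ⟨b, hb⟩)
    · exact iff_of_false (fun h => hb ((hmem b).1 h.snd_mem)) fun h => hb h.snd_mem
  · exact iff_of_false (fun h => ha ((hmem a).1 h.fst_mem)) fun h => ha h.fst_mem

/-- The permutations that map `τ` onto a copy form a coset of the stabiliser of `τ`. -/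
theorem card_mapsOnto [Finite V] {τ : G.Subgraph} {S : T.Subgraph} (φ : S.coe ≃g τ.coe) :
    Nat.card {π // MapsOnto τ S π} = Nat.card {π // MapsOnto τ τ π} := by
  obtain ⟨π₀, h₀⟩ := exists_mapsOnto φ
  refine Nat.card_congr ((Equiv.mulLeft π₀⁻¹).subtypeEquiv fun π => ?_)
  have hπ : ∀ a, π a = π₀ ((π₀⁻¹ * π) a) := fun a => by simp
  simp only [MapsOnto, Equiv.coe_mulLeft, hπ, h₀.1, h₀.2]

/-- The image of `τ` under a permutation that maps its edges to edges of `T`. -/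
def imageSubgraph (τ : G.Subgraph) (T : SimpleGraph V) (π : Equiv.Perm V)
    (h : ∀ a b, τ.Adj a b → T.Adj (π a) (π b)) : T.Subgraph where
  verts := {v | π.symm v ∈ τ.verts}
  Adj a b := τ.Adj (π.symm a) (π.symm b)
  adj_sub {a b} hab := by simpa using h _ _ hab
  edge_vert hab := hab.fst_mem
  symm := ⟨fun _ _ hab => hab.symm⟩

/-- A permutation that carries the edges of `τ` into `T` determines its image, a copy of `τ`. All
fibres over copies have the size of the stabiliser, by `card_mapsOnto`. Isolated vertices cause no
trouble, since `T` has all vertices. -/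
theorem card_embeddings [Finite V] (τ : G.Subgraph) (T : SimpleGraph V) :
    Nat.card {π : Equiv.Perm V // ∀ a b, τ.Adj a b → T.Adj (π a) (π b)} =
      Nat.card {S : T.Subgraph // Nonempty (S.coe ≃g τ.coe)} *
        Nat.card {π // MapsOnto τ τ π} := by
  classical
  have := Fintype.ofFinite V
  have : Fintype {S : T.Subgraph // Nonempty (S.coe ≃g τ.coe)} := Fintype.ofFinite _
  have h1 : Nat.card (Σ S : {S : T.Subgraph // Nonempty (S.coe ≃g τ.coe)},
      {π // MapsOnto τ S.1 π}) = Nat.card {S : T.Subgraph // Nonempty (S.coe ≃g τ.coe)} *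
        Nat.card {π // MapsOnto τ τ π} := by
    rw [Nat.card_sigma, Finset.sum_congr rfl fun S _ => card_mapsOnto S.2.some, Finset.sum_const,
      smul_eq_mul, Finset.card_univ, ← Nat.card_eq_fintype_card]
  rw [← h1]
  symm
  refine Nat.card_eq_of_bijective
    (fun x => ⟨x.2.1, fun a b h => ((x.2.2.2 a b).2 h).adj_sub⟩) ⟨?_, ?_⟩
  · rintro ⟨⟨S, hS⟩, π, h⟩ ⟨⟨S', hS'⟩, π', h'⟩ heq
    obtain rfl : π = π' := congrArg Subtype.val heq
    obtain rfl : S = S' := by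
      refine SimpleGraph.Subgraph.ext ?_ ?_
      · ext v
        obtain ⟨a, rfl⟩ := π.surjective v
        rw [h.1, h'.1]
      · ext v w
        obtain ⟨a, rfl⟩ := π.surjective v
        obtain ⟨b, rfl⟩ := π.surjective w
        rw [h.2, h'.2]
    rfl
  · rintro ⟨π, h⟩
    have hm : MapsOnto τ (imageSubgraph τ T π h) π :=
      ⟨fun a => by simp [imageSubgraph], fun a b => by simp [imageSubgraph]⟩
    have φ : τ.coe ≃g (imageSubgraph τ T π h).coe :=
      { toEquiv := π.subtypeEquiv fun a => (hm.1 a).symm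
        map_rel_iff' := by
          intro a b
          exact hm.2 a b }
    exact ⟨⟨⟨_, ⟨φ.symm⟩⟩, π, hm⟩, rfl⟩

end Copies

/-! ### From an encoded subtree to the law of the output -/

section Encoding

variable {n : ℕ} {τ : (⊤ : SimpleGraph (Fin n)).Subgraph} {vs : List (Fin n)}
  {es : List (Fin n × Fin n)}

theorem Encodes.adj_iff (h : Encodes τ vs es) (a b : Fin n) :
    τ.Adj a b ↔ ∃ e ∈ es, s(e.1, e.2) = s(a, b) := by
  rw [← SimpleGraph.Subgraph.mem_edgeSet, ← h.2.2.2, List.mem_map]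

theorem Encodes.adj (h : Encodes τ vs es) {e : Fin n × Fin n} (he : e ∈ es) : τ.Adj e.1 e.2 :=
  (h.adj_iff _ _).2 ⟨e, he, rfl⟩

theorem Encodes.treeInput (h : Encodes τ vs es) (hτ : τ.coe.IsTree) : TreeInput vs es := by
  classical
  have hadj : ∀ a b, τ.Adj a b → (edgeGraph es).Adj a b := by
    intro a b hab
    obtain ⟨e, he, heq⟩ := (h.adj_iff a b).1 hab
    rw [edgeGraph_adj]
    refine ⟨?_, hab.ne⟩
    rcases Sym2.eq_iff.1 heq with ⟨h1, h2⟩ | ⟨h1, h2⟩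
    · left; rw [← h1, ← h2]; exact he
    · right; rw [← h1, ← h2]; exact he
  refine ⟨h.1, ?_, ?_, ?_, ?_, fun e he => (h.adj he).ne⟩
  · obtain ⟨v⟩ := hτ.1.nonempty
    exact List.ne_nil_of_mem ((h.2.1 v).2 v.2)
  · have hcard := (SimpleGraph.isTree_iff_connected_and_card.1 hτ).2
    have hv : Nat.card τ.verts = vs.length := by
      have : τ.verts = (vs.toFinset : Set (Fin n)) := by
        ext v; simp [h.2.1]
      rw [this, Nat.card_coe_set_eq, Set.ncard_coe_finset, List.toFinset_card_of_nodup h.1]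
    have he : Nat.card τ.coe.edgeSet = es.length := by
      have h1 : τ.edgeSet = ((es.map fun e => s(e.1, e.2)).toFinset : Set (Sym2 (Fin n))) := by
        ext e
        rw [← h.2.2.2]
        simp
      rw [Nat.card_coe_set_eq, ← Set.ncard_image_of_injective _
        (Sym2.map.injective Subtype.val_injective), SimpleGraph.Subgraph.image_coe_edgeSet_coe, h1,
        Set.ncard_coe_finset, List.toFinset_card_of_nodup h.2.2.1, List.length_map]
    rw [← hv, ← he]
    exact hcard
  · intro a ha b hb
    have hr := hτ.1 ⟨a, (h.2.1 a).1 ha⟩ ⟨b, (h.2.1 b).1 hb⟩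
    exact hr.map (⟨Subtype.val, fun {x y} hxy => hadj x y hxy⟩ : τ.coe →g edgeGraph es)
  · intro e he
    rw [h.2.1, h.2.1]
    exact ⟨(h.adj he).fst_mem, (h.adj he).snd_mem⟩

theorem Encodes.forall_adj_iff (h : Encodes τ vs es) (T : SimpleGraph (Fin n))
    (π : Equiv.Perm (Fin n)) :
    (∀ e ∈ es, T.Adj (π e.1) (π e.2)) ↔ ∀ a b, τ.Adj a b → T.Adj (π a) (π b) := by
  constructor
  · intro H a b hab
    obtain ⟨e, he, heq⟩ := (h.adj_iff a b).1 hab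
    rcases Sym2.eq_iff.1 heq with ⟨h1, h2⟩ | ⟨h1, h2⟩
    · rw [← h1, ← h2]; exact H e he
    · rw [← h1, ← h2]; exact (H e he).symm
  · intro H e he
    exact H _ _ (h.adj he)

/-- The factor collects the completion weight, `1 / n!` and the order of the stabiliser of `τ`. Only
its independence of `T` is kept. -/
theorem exists_outputProb_eq_mul_copies (h : Encodes τ vs es) (hτ : τ.coe.IsTree) :
    ∃ κ : ℝ≥0∞, ∀ T : SimpleGraph (Fin n), T.IsTree →
      outputProb vs es T = κ * (copies τ T : ℝ≥0∞) := by
  refine ⟨ENNReal.ofReal (completionWeight n vs.length / n.factorial) *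
    (Nat.card {π // MapsOnto τ τ π} : ℝ≥0∞), fun T hT => ?_⟩
  rw [outputProb_eq (h.treeInput hτ) hT, copies]
  simp only [h.forall_adj_iff T, card_embeddings]
  push_cast
  ring

/-- Summing the proportionality over all trees gives total mass one, since other graphs have
probability zero. So the factor is the inverse of the total number of copies, and this number is
never computed. -/
theorem outputProb_eq_div (h : Encodes τ vs es) (hτ : τ.coe.IsTree) (T : SimpleGraph (Fin n))
    (hT : T.IsTree) : outputProb vs es T = (copies τ T : ℝ≥0∞) /
      ∑' T' : {T' : SimpleGraph (Fin n) // T'.IsTree}, (copies τ T'.1 : ℝ≥0∞) := by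
  obtain ⟨κ, hκ⟩ := exists_outputProb_eq_mul_copies h hτ
  have hin := h.treeInput hτ
  have h1 : κ * ∑' T' : {T' : SimpleGraph (Fin n) // T'.IsTree}, (copies τ T'.1 : ℝ≥0∞) = 1 := by
    rw [← ENNReal.tsum_mul_left, ← tsum_outputProb hin]
    rw [tsum_congr fun T' : {T' : SimpleGraph (Fin n) // T'.IsTree} => (hκ T'.1 T'.2).symm]
    exact tsum_subtype_eq_of_support_subset (s := {T' : SimpleGraph (Fin n) | T'.IsTree})
      fun T' hT' => by_contra fun hn => hT' (outputProb_of_not_isTree hin hn)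
  rw [hκ T hT, ENNReal.eq_inv_of_mul_eq_one_left h1, ENNReal.div_eq_inv_mul]

end Encoding

end SeededTree

end

theorem mainTheorem9 :
    ∃ C : ℝ≥0, ∀ (n : ℕ) (τ : (⊤ : SimpleGraph (Fin n)).Subgraph), τ.coe.IsTree →
      ∀ (vs : List (Fin n)) (es : List (Fin n × Fin n)), SeededTree.Encodes τ vs es →
        (∀ T : SimpleGraph (Fin n), T.IsTree →
          SeededTree.outputProb vs es T =
            (SeededTree.copies τ T : ℝ≥0∞) /
              ∑' T' : {T' : SimpleGraph (Fin n) // T'.IsTree},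
                (SeededTree.copies τ T'.1 : ℝ≥0∞)) ∧
        (∀ T : SimpleGraph (Fin n), ¬ T.IsTree → SeededTree.outputProb vs es T = 0) ∧
        (∑' T : SimpleGraph (Fin n), SeededTree.outputProb vs es T = 1) ∧
        SeededTree.expectedTime vs es ≤ (C : ℝ≥0∞) * (n : ℝ≥0∞) := by
  refine ⟨15, fun n τ hτ vs es h => ⟨SeededTree.outputProb_eq_div h hτ, fun T hT =>
    SeededTree.outputProb_of_not_isTree (h.treeInput hτ) hT,
    SeededTree.tsum_outputProb (h.treeInput hτ), ?_⟩⟩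
  simpa using SeededTree.expectedTime_le (h.treeInput hτ)
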